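/- Let $X$ be a Hausdorff space and let $\mathfrak M(X)$ be the real vector space of real-valued Borel measures $\eta$ of bounded variation on $X$ whose variation $|\eta|$ is a Radon measure (inner regular with respect to compact sets and outer regular with respect to open sets, on all Borel sets). Let $\psi:[0,\infty)\to\mathbb R$ be a Bernstein function, not necessarily nonnegative: $\psi$ is continuous on $[0,\infty)$, $C^\infty$ on $(0,\infty)$, and $\psi'$ is completely monotone on $(0,\infty)$, that is, $(-1)^n(\psi')^{(n)}\ge 0$ on $(0,\infty)$ for all $n\ge 0$. Let $\gamma:X\times X\to[0,\infty)$ be a continuous conditionally negative definite kernel, that is, $\gamma$ is symmetric and $\sum_{i,j=1}^n c_ic_j\gamma(x_i,x_j)\le 0$ for all $n$, all $x_1,\dots,x_n\in X$ and all $c_1,\dots,c_n\in\mathbb R$ with $\sum_i c_i=0$. Assume that $x\mapsto\gamma(x,x)$ is bounded. Put $$\mathfrak M_1(X;\gamma,\psi):=\{\eta\in\mathfrak M(X):\ \psi(\gamma(x,y))\in L^1(|\eta|\times|\eta|)\ \text{ and }\ \eta(X)=0\}.$$ Then $\mathfrak M_1(X;\gamma,\psi)$ is a vector space, $\psi(\gamma(x,y))\in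 L^1(|\mu|\times|\nu|)$ for all $\mu,\nu\in\mathfrak M_1(X;\gamma,\psi)$, and $$I(\mu,\nu)_{\gamma,\psi}:=-\int_X\int_X\psi(\gamma(x,y))\,d\mu(x)\,d\nu(y)$$ defines a semi-inner product on $\mathfrak M_1(X;\gamma,\psi)$: it is bilinear and symmetric, and $I(\mu,\mu)_{\gamma,\psi}\ge 0$ for every $\mu$. If moreover $\psi$ is not of the form $t\mapsto a+bt$ with $a,b\in\mathbb R$, and $2\gamma(x,y)=\gamma(x,x)+\gamma(y,y)$ holds only when $x=y$, then $I$ is an inner product on $\mathfrak M_1(X;\gamma,\psi)$: $I(\mu,\mu)_{\gamma,\psi}=0$ only for $\mu=0$. -/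

import Mathlib

open MeasureTheory

noncomputable section

/-- `f` is completely monotone on `(0, ∞)`: it is smooth there and `(-1)ⁿ f⁽ⁿ⁾ ≥ 0` for every
`n ≥ 0`. Only the values of `f` on `(0, ∞)` matter. -/
def IsCompletelyMonotone (f : ℝ → ℝ) : Prop :=
  ContDiffOn ℝ ((⊤ : ℕ∞) : WithTop ℕ∞) f (Set.Ioi 0) ∧
    ∀ n : ℕ, ∀ t : ℝ, 0 < t → 0 ≤ (-1 : ℝ) ^ n * iteratedDeriv n f t

/-- A (not necessarily nonnegative) Bernstein function `ψ : [0, ∞) → ℝ`: continuous on `[0, ∞)`,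
smooth on `(0, ∞)`, with completely monotone derivative on `(0, ∞)`. It is represented by a function
on `ℝ` of which only the values on `[0, ∞)` matter. -/
def IsBernstein (ψ : ℝ → ℝ) : Prop :=
  ContinuousOn ψ (Set.Ici 0) ∧
    ContDiffOn ℝ ((⊤ : ℕ∞) : WithTop ℕ∞) ψ (Set.Ioi 0) ∧
    IsCompletelyMonotone (deriv ψ)

/-- A real-valued conditionally negative definite kernel: symmetric, with nonpositive quadratic form
on finite systems of real coefficients of sum zero. -/
def IsCND {X : Type*} (γ : X → X → ℝ) : Prop :=
  (∀ x y, γ x y = γ y x) ∧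
    ∀ (n : ℕ) (x : Fin n → X) (c : Fin n → ℝ), ∑ i, c i = 0 →
      ∑ i, ∑ j, c i * c j * γ (x i) (x j) ≤ 0

/-- A nonnegative Borel measure is Radon: finite on compact sets, inner regular with respect to
compact sets on all Borel sets, and outer regular with respect to open sets on all Borel sets. -/
def IsRadonMeasure {X : Type*} [TopologicalSpace X] [MeasurableSpace X] (m : Measure X) : Prop :=
  IsFiniteMeasureOnCompacts m ∧ m.InnerRegular ∧ m.OuterRegular

/-- The real-valued measures `η` (of bounded variation) that are Radon, have total mass zero and
satisfy `ψ ∘ γ ∈ L¹(|η| × |η|)`. -/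
def energySpace {X : Type*} [TopologicalSpace X] [MeasurableSpace X]
    (γ : X → X → ℝ) (ψ : ℝ → ℝ) : Set (SignedMeasure X) :=
  {η | IsRadonMeasure η.totalVariation ∧
    Integrable (fun p : X × X => ψ (γ p.1 p.2)) (η.totalVariation.prod η.totalVariation) ∧
    η Set.univ = 0}

/-- `I(μ, ν) = - ∫ ∫ ψ(γ(x, y)) dμ(x) dν(y)`, with the integrals against signed measures. -/
def energyForm {X : Type*} [MeasurableSpace X] (γ : X → X → ℝ) (ψ : ℝ → ℝ)
    (μ ν : SignedMeasure X) : ℝ :=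
  - ∫ᵛ y, (∫ᵛ x, ψ (γ x y) ∂•μ) ∂•ν

end

/-! Bernstein's theorem makes `ψ'` the Laplace transform of a measure ρ on [0, ∞). Hence ψ(t) - ψ(0)
= ∫ L(t, u) dρ(u), where L(t, u) = (1 - e^{-ut})/u for u > 0 and L(t, 0) = t
(`IsBernstein.exists_measure`). Write μ = s|μ| with |s| = 1. As μ(X) = 0, constants have zero
energy, so Fubini gives I(μ, μ) = ∫ J dρ with J(u) = u⁻¹ ∬ e^{-uγ} dμ dμ for u > 0; an atom of ρ at
0 is treated as the limit u → 0.

By Schoenberg, γ(x, y) = ‖φ x - φ y‖² + γ(x, x)/2 + γ(y, y)/2 for a continuous Hilbert-space map φ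
(`IsCND.exists_featureMap`). The diagonal terms are absorbed into the density, and the Gaussian
kernel is itself a Gram kernel, so J(u) is u⁻¹ times the squared norm of a vector integral
(`gaussian_energy_nonneg`). This yields I(μ, μ) ≥ 0.

If I(μ, μ) = 0, then J = 0 ρ-almost everywhere. For `ψ` not affine, ρ charges (0, ∞), so some
Gaussian energy with u > 0 vanishes, and with it the Gaussian potential on all of H. Completing the
square turns this into a vanishing Laplace transform; analytic continuation and uniqueness of
characteristic functionals, with φ injective, give s = 0 almost everywhere
(`ae_eq_zero_of_gaussian_potential_eq_zero`), that is μ = 0.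

Linearity of the space rests on ψ(γ(x, y)) - ψ(0) being at most twice the sum of the same quantities
at (x, z) and (z, y): finite energy then means that every one-point potential is integrable, a
condition stable under sums. -/

section BernsteinEnergy

open Filter Topology Set
open scoped RealInnerProductSpace

universe u

/-! ### The Hausdorff moment problem on [0, 1]. -/

/-- The forward difference operator `a ↦ (k ↦ a k - a (k + 1))` on real sequences. -/
def seqDiff (a : ℕ → ℝ) (k : ℕ) : ℝ := a k - a (k + 1)

/-- Completely monotone sequences: all iterated differences are nonnegative. -/
def IsCompletelyMonotoneSeq (a : ℕ → ℝ) : Prop := ∀ n k, 0 ≤ (seqDiff^[n] a) k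

/-- The Bernstein weights attached to a sequence. -/
def bernsteinWeight (a : ℕ → ℝ) (n k : ℕ) : ℝ := n.choose k * (seqDiff^[n - k] a) k

theorem iterate_seqDiff_shift (a : ℕ → ℝ) (n k : ℕ) :
    (seqDiff^[n] fun i => a (i + 1)) k = (seqDiff^[n] a) (k + 1) := by
  induction n generalizing a with
  | zero => rfl
  | succ n ih =>
    rw [Function.iterate_succ_apply, Function.iterate_succ_apply, ← ih]
    rfl

theorem IsCompletelyMonotoneSeq.shift {a : ℕ → ℝ} (ha : IsCompletelyMonotoneSeq a) :
    IsCompletelyMonotoneSeq fun i => a (i + 1) := fun n k => by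
  rw [iterate_seqDiff_shift]
  exact ha n (k + 1)

theorem IsCompletelyMonotoneSeq.bernsteinWeight_nonneg {a : ℕ → ℝ}
    (ha : IsCompletelyMonotoneSeq a) (n k : ℕ) : 0 ≤ bernsteinWeight a n k :=
  mul_nonneg (Nat.cast_nonneg _) (ha _ _)

/-- The factor (k + 1)/(n + 1) is the node carrying the weight on the right: shifting the sequence
multiplies the discrete measure by x. This drives the induction on the order of the moment. -/
theorem bernsteinWeight_shift (a : ℕ → ℝ) (n k : ℕ) :
    bernsteinWeight (fun i => a (i + 1)) n k =
      ((k + 1 : ℝ) / (n + 1)) * bernsteinWeight a (n + 1) (k + 1) := by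
  rw [bernsteinWeight, bernsteinWeight, iterate_seqDiff_shift, Nat.add_sub_add_right]
  have h : ((n + 1 : ℕ) : ℝ) * n.choose k = (n + 1).choose (k + 1) * ((k + 1 : ℕ) : ℝ) := by
    exact_mod_cast Nat.add_one_mul_choose_eq n k
  push_cast at h
  field_simp
  linear_combination (seqDiff^[n - k] a) (k + 1) * h

/-- Binomial expansion of (E + (1 - E))ⁿ = 1, with E the shift operator, evaluated on `a` at index
0. -/
theorem sum_bernsteinWeight (a : ℕ → ℝ) (n : ℕ) :
    ∑ k ∈ Finset.range (n + 1), bernsteinWeight a n k = a 0 := by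
  let E : Module.End ℝ (ℕ → ℝ) :=
    { toFun := fun a k => a (k + 1), map_add' := fun _ _ => rfl, map_smul' := fun _ _ => rfl }
  have hE : ∀ k (b : ℕ → ℝ) i, (E ^ k) b i = b (i + k) := by
    intro k
    induction k with
    | zero => intro b i; rfl
    | succ k ih =>
      intro b i
      rw [pow_succ', Module.End.mul_apply]
      change (E ^ k) b (i + 1) = _
      rw [ih]; congr 1; ring
  have hD : ∀ k (b : ℕ → ℝ), ((1 - E) ^ k) b = seqDiff^[k] b := by
    intro k b
    rw [Module.End.pow_apply]; rfl
  have h : (E + (1 - E)) ^ n = 1 := by rw [add_sub_cancel, one_pow]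
  have hc : Commute E (1 - E) := (Commute.one_right E).sub_right (Commute.refl E)
  rw [hc.add_pow] at h
  have h2 := congrFun (congrArg (fun T : Module.End ℝ (ℕ → ℝ) => T a) h) 0
  simp only [LinearMap.sum_apply, Finset.sum_apply, Module.End.one_apply] at h2
  rw [← h2]
  refine Finset.sum_congr rfl fun k _ => ?_
  rw [bernsteinWeight, ← (Nat.cast_commute (n.choose k) (E ^ k * (1 - E) ^ (n - k))).eq,
    ← nsmul_eq_mul (n.choose k) (E ^ k * (1 - E) ^ (n - k)), LinearMap.smul_apply,
    Pi.smul_apply, Module.End.mul_apply, hE, hD, nsmul_eq_mul, zero_add]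

theorem IsCompletelyMonotoneSeq.tendsto_sum_bernsteinWeight (j : ℕ) {a : ℕ → ℝ}
    (ha : IsCompletelyMonotoneSeq a) :
    Tendsto (fun n : ℕ => ∑ k ∈ Finset.range (n + 1), bernsteinWeight a n k * ((k : ℝ) / n) ^ j)
      atTop (𝓝 (a j)) := by
  induction j generalizing a with
  | zero =>
    simp only [pow_zero, mul_one, sum_bernsteinWeight]
    exact tendsto_const_nhds
  | succ j ih =>
    rw [← tendsto_add_atTop_iff_nat 1]
    have h1 := ih ha.shift
    have h2 : Tendsto (fun n : ℕ => a 0 * (j * (1 / ((n : ℝ) + 1)))) atTop (𝓝 0) := by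
      simpa using (tendsto_one_div_add_atTop_nhds_zero_nat (𝕜 := ℝ)).const_mul (j : ℝ)
        |>.const_mul (a 0)
    -- After the shift identity the two sums differ only through the nodes (k + 1)/(n + 1) and k/n,
    -- which are within 1/(n + 1) of each other; the total weight is `a 0`.
    have key : ∀ᶠ n : ℕ in atTop,
        ‖(∑ k ∈ Finset.range (n + 1 + 1),
            bernsteinWeight a (n + 1) k * ((k : ℝ) / (n + 1 : ℕ)) ^ (j + 1)) -
          ∑ k ∈ Finset.range (n + 1), bernsteinWeight (fun i => a (i + 1)) n k *
            ((k : ℝ) / n) ^ j‖ ≤ a 0 * (j * (1 / ((n : ℝ) + 1))) := by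
      filter_upwards [eventually_ge_atTop 1] with n hn
      have hn0 : (0 : ℝ) < n := by exact_mod_cast hn
      rw [Finset.sum_range_succ']
      simp only [Nat.cast_zero, zero_div, zero_pow (Nat.succ_ne_zero j), mul_zero, add_zero]
      rw [← Finset.sum_sub_distrib]
      have hS : a 0 * (j * (1 / ((n : ℝ) + 1))) =
          ∑ k ∈ Finset.range (n + 1 + 1), bernsteinWeight a (n + 1) k * (j * (1 / ((n : ℝ) + 1))) := by
        rw [← Finset.sum_mul, sum_bernsteinWeight]
      rw [hS, Finset.sum_range_succ' _ (n + 1)]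
      rw [Real.norm_eq_abs]
      refine (Finset.abs_sum_le_sum_abs (G := ℝ) _ _).trans ?_
      refine le_add_of_le_of_nonneg (Finset.sum_le_sum fun k hk => ?_)
        (mul_nonneg (ha.bernsteinWeight_nonneg _ _) (by positivity))
      have hk' : (k : ℝ) ≤ n := by exact_mod_cast Finset.mem_range_succ_iff.1 hk
      rw [bernsteinWeight_shift]
      set w := bernsteinWeight a (n + 1) (k + 1)
      have hw : 0 ≤ w := ha.bernsteinWeight_nonneg _ _
      push_cast
      set x : ℝ := (k + 1 : ℝ) / (n + 1)
      set y : ℝ := (k : ℝ) / n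
      have hx0 : 0 ≤ x := by positivity
      have hx1 : x ≤ 1 := by
        rw [div_le_one (by positivity)]; linarith
      have hy0 : 0 ≤ y := by positivity
      have hy1 : y ≤ 1 := by rw [div_le_one hn0]; exact hk'
      have hxy : |x - y| ≤ 1 / ((n : ℝ) + 1) := by
        have : x - y = (n - k) / n * (1 / ((n : ℝ) + 1)) := by
          simp only [x, y]; field_simp; ring
        rw [this, abs_of_nonneg (mul_nonneg (div_nonneg (by linarith) hn0.le) (by positivity))]
        refine mul_le_of_le_one_left (by positivity) ?_
        rw [div_le_one hn0]; linarith [(Nat.cast_nonneg k : (0 : ℝ) ≤ k)]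
      have hpow : |x ^ j - y ^ j| ≤ j * (1 / ((n : ℝ) + 1)) := by
        have h := abs_pow_sub_pow_le x y j
        refine h.trans ?_
        have hm : max |x| |y| ≤ 1 := by
          rw [abs_of_nonneg hx0, abs_of_nonneg hy0]; exact max_le hx1 hy1
        calc |x - y| * j * max |x| |y| ^ (j - 1) ≤ |x - y| * j * 1 := by
              gcongr
              exact pow_le_one₀ (le_max_of_le_left (abs_nonneg _)) hm
          _ ≤ j * (1 / ((n : ℝ) + 1)) := by rw [mul_one, mul_comm]; gcongr
      have : w * x ^ (j + 1) - x * w * y ^ j = w * (x * (x ^ j - y ^ j)) := by ring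
      rw [this, abs_mul, abs_of_nonneg hw]
      gcongr
      rw [abs_mul, abs_of_nonneg hx0]
      exact (mul_le_of_le_one_left (abs_nonneg _) hx1).trans hpow
    have h3 := squeeze_zero_norm' key h2
    simpa using h3.add h1

/-- **Hausdorff moment theorem**. -/
theorem IsCompletelyMonotoneSeq.exists_measure {a : ℕ → ℝ} (ha : IsCompletelyMonotoneSeq a) :
    ∃ ν : Measure unitInterval, IsFiniteMeasure ν ∧ ∀ k, ∫ x, (x : ℝ) ^ k ∂ν = a k := by
  have hanti : ∀ k, a (k + 1) ≤ a k := fun k => sub_nonneg.1 (ha 1 k)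
  have h0 : ∀ k, 0 ≤ a k := fun k => ha 0 k
  rcases eq_or_ne (a 0) 0 with h | h
  · refine ⟨0, inferInstance, fun k => ?_⟩
    have : a k ≤ a 0 := antitone_nat_of_succ_le hanti (Nat.zero_le k)
    simp only [integral_zero_measure]
    linarith [h0 k]
  have hpos : 0 < a 0 := lt_of_le_of_ne (h0 0) h.symm
  let pt : ℕ → ℕ → unitInterval := fun n k => Set.projIcc 0 1 zero_le_one ((k : ℝ) / n)
  have hpt : ∀ n k, k ≤ n → ((pt n k : unitInterval) : ℝ) = (k : ℝ) / n := by
    intro n k hk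
    have hmem : (k : ℝ) / n ∈ Set.Icc (0 : ℝ) 1 :=
      ⟨by positivity, div_le_one_of_le₀ (by exact_mod_cast hk) (Nat.cast_nonneg _)⟩
    simp only [pt, Set.projIcc_of_mem _ hmem]
  -- Dividing by `a 0` gives probability measures, which form a compact space over [0, 1]; a limit
  -- along an ultrafilter has the required moments.
  let M : ℕ → Measure unitInterval := fun n => ∑ k ∈ Finset.range (n + 1),
    ENNReal.ofReal (bernsteinWeight a n k / a 0) • Measure.dirac (pt n k)
  have hnn : ∀ n k, 0 ≤ bernsteinWeight a n k / a 0 := fun n k =>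
    div_nonneg (ha.bernsteinWeight_nonneg n k) hpos.le
  have hprob : ∀ n, IsProbabilityMeasure (M n) := by
    intro n
    constructor
    simp only [M, Measure.coe_finsetSum, Finset.sum_apply, Measure.smul_apply, measure_univ,
      smul_eq_mul, mul_one]
    rw [← ENNReal.ofReal_sum_of_nonneg fun k _ => hnn n k, ← Finset.sum_div, sum_bernsteinWeight,
      div_self h, ENNReal.ofReal_one]
  let Q : ℕ → ProbabilityMeasure unitInterval := fun n => ⟨M n, hprob n⟩
  obtain ⟨P, -, hP⟩ := isCompact_univ.ultrafilter_le_nhds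
    ((hyperfilter ℕ).map Q) (by simp)
  have hQ : Tendsto Q (hyperfilter ℕ) (𝓝 P) := hP
  rw [ProbabilityMeasure.tendsto_iff_forall_integral_tendsto] at hQ
  refine ⟨ENNReal.ofReal (a 0) • (P : Measure unitInterval),
    Measure.smul_finite _ ENNReal.ofReal_ne_top, fun j => ?_⟩
  let g : BoundedContinuousFunction unitInterval ℝ :=
    BoundedContinuousFunction.mkOfCompact ⟨fun x => (x : ℝ) ^ j, by fun_prop⟩
  have h1 : Tendsto (fun n => ∫ x, g x ∂(M n)) (hyperfilter ℕ) (𝓝 (∫ x, g x ∂(P : Measure _))) :=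
    hQ g
  have h2 : ∀ n, ∫ x, g x ∂(M n) =
      (∑ k ∈ Finset.range (n + 1), bernsteinWeight a n k * ((k : ℝ) / n) ^ j) / a 0 := by
    intro n
    rw [integral_finsetSum_measure fun k _ => ?_, Finset.sum_div]
    · refine Finset.sum_congr rfl fun k hk => ?_
      rw [integral_smul_measure, integral_dirac, ENNReal.toReal_ofReal (hnn n k)]
      simp only [g, BoundedContinuousFunction.mkOfCompact_apply, ContinuousMap.coe_mk, smul_eq_mul]
      rw [hpt n k (Finset.mem_range_succ_iff.1 hk)]
      ring
    · exact (g.integrable _).smul_measure ENNReal.ofReal_ne_top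
  simp only [h2] at h1
  have h3 := ((ha.tendsto_sum_bernsteinWeight j).div_const (a 0)).mono_left
    (Nat.hyperfilter_le_atTop)
  have h4 := tendsto_nhds_unique h1 h3
  rw [integral_smul_measure, ENNReal.toReal_ofReal hpos.le, smul_eq_mul]
  have : ∫ x : unitInterval, (x : ℝ) ^ j ∂(P : Measure unitInterval) = a j / a 0 := h4
  rw [this]; field_simp

/-- Finite measures on the unit interval are determined by their moments. -/
theorem ext_of_forall_integral_pow_eq {μ ν : Measure unitInterval} [IsFiniteMeasure μ]
    [IsFiniteMeasure ν] (h : ∀ k : ℕ, ∫ x, (x : ℝ) ^ k ∂μ = ∫ x, (x : ℝ) ^ k ∂ν) : μ = ν := by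
  have hint : ∀ (m : Measure unitInterval) [IsFiniteMeasure m] (f : C(unitInterval, ℝ)),
      Integrable f m := fun m _ f =>
    (BoundedContinuousFunction.mkOfCompact f).integrable m
  have hcont : ∀ (m : Measure unitInterval) [IsFiniteMeasure m],
      Continuous fun f : C(unitInterval, ℝ) => ∫ x, f x ∂m := by
    intro m _
    refine (LipschitzWith.of_dist_le_mul (K := m.real univ |>.toNNReal) fun f g => ?_).continuous
    rw [dist_eq_norm, ← integral_sub (hint m f) (hint m g), Real.coe_toNNReal _ measureReal_nonneg,
      mul_comm]
    refine norm_integral_le_of_norm_le_const (Eventually.of_forall fun x => ?_)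
    rw [← dist_eq_norm]
    exact ContinuousMap.dist_apply_le_dist x
  have hcl : IsClosed {f : C(unitInterval, ℝ) | ∫ x, f x ∂μ = ∫ x, f x ∂ν} :=
    isClosed_eq (hcont μ) (hcont ν)
  have hpoly : (polynomialFunctions unitInterval : Set C(unitInterval, ℝ)) ⊆
      {f : C(unitInterval, ℝ) | ∫ x, f x ∂μ = ∫ x, f x ∂ν} := by
    rintro _ ⟨p, -, rfl⟩
    have hp : ∀ (m : Measure unitInterval) [IsFiniteMeasure m],
        ∫ x : unitInterval, p.eval (x : ℝ) ∂m = p.sum fun k c => c * ∫ x, (x : ℝ) ^ k ∂m := by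
      intro m _
      simp only [Polynomial.eval_eq_sum, Polynomial.sum_def]
      rw [integral_finsetSum]
      · simp only [integral_const_mul]
      · intro k _
        exact hint m ⟨fun x : unitInterval => p.coeff k * (x : ℝ) ^ k, by fun_prop⟩
    change ∫ x : unitInterval, p.eval (x : ℝ) ∂μ = ∫ x : unitInterval, p.eval (x : ℝ) ∂ν
    rw [hp μ, hp ν]
    simp only [h]
  refine ext_of_forall_integral_eq_of_IsFiniteMeasure fun f => ?_
  have hmem : f.toContinuousMap ∈ closure (polynomialFunctions unitInterval : Set _) := by
    rw [← Subalgebra.topologicalClosure_coe, polynomialFunctions_closure_eq_top']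
    trivial
  exact hcl.closure_subset_iff.2 hpoly hmem

/-! ### Bernstein's theorem on completely monotone functions. -/

theorem IsCompletelyMonotone.contDiffAt {f : ℝ → ℝ} (hf : IsCompletelyMonotone f) {t : ℝ}
    (ht : 0 < t) : ContDiffAt ℝ ((⊤ : ℕ∞) : WithTop ℕ∞) f t :=
  hf.1.contDiffAt (Ioi_mem_nhds ht)

theorem IsCompletelyMonotone.contDiffOn_iteratedDeriv {f : ℝ → ℝ} (hf : IsCompletelyMonotone f)
    (n : ℕ) : ContDiffOn ℝ ((⊤ : ℕ∞) : WithTop ℕ∞) (iteratedDeriv n f) (Ioi 0) := by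
  induction n with
  | zero => simpa using hf.1
  | succ n ih =>
    rw [iteratedDeriv_succ]
    exact ih.deriv_of_isOpen isOpen_Ioi (by exact_mod_cast le_top)

theorem IsCompletelyMonotone.hasDerivAt_iteratedDeriv {f : ℝ → ℝ} (hf : IsCompletelyMonotone f)
    (n : ℕ) {t : ℝ} (ht : 0 < t) :
    HasDerivAt (iteratedDeriv n f) (iteratedDeriv (n + 1) f t) t := by
  rw [iteratedDeriv_succ]
  exact (((hf.contDiffOn_iteratedDeriv n).contDiffAt (Ioi_mem_nhds ht)).differentiableAt
    (by simp)).hasDerivAt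

theorem IsCompletelyMonotone.antitoneOn {f : ℝ → ℝ} (hf : IsCompletelyMonotone f) (n : ℕ) :
    AntitoneOn (fun t => (-1 : ℝ) ^ n * iteratedDeriv n f t) (Ioi 0) := by
  have hd : ∀ t ∈ Ioi (0 : ℝ), HasDerivAt (fun t => (-1 : ℝ) ^ n * iteratedDeriv n f t)
      ((-1 : ℝ) ^ n * iteratedDeriv (n + 1) f t) t := fun t ht =>
    (hf.hasDerivAt_iteratedDeriv n ht).const_mul _
  refine antitoneOn_of_deriv_nonpos (convex_Ioi 0)
    (fun t ht => (hd t ht).continuousAt.continuousWithinAt)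
    (fun t ht => ?_) fun t ht => ?_
  · rw [interior_Ioi] at ht
    exact (hd t ht).differentiableAt.differentiableWithinAt
  · rw [interior_Ioi] at ht
    rw [(hd t ht).deriv]
    have := hf.2 (n + 1) t ht
    rw [pow_succ] at this
    linarith

theorem IsCompletelyMonotone.sub_shift {f : ℝ → ℝ} (hf : IsCompletelyMonotone f) {h : ℝ}
    (hh : 0 < h) : IsCompletelyMonotone fun t => f t - f (t + h) := by
  have hs : ∀ t : ℝ, 0 < t → ContDiffAt ℝ ((⊤ : ℕ∞) : WithTop ℕ∞) (fun t => f (t + h)) t :=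
    fun t ht => (hf.contDiffAt (by linarith : 0 < t + h)).comp t (by fun_prop)
  refine ⟨fun t ht => ((hf.contDiffAt ht).sub (hs t ht)).contDiffWithinAt, fun n t ht => ?_⟩
  have h1 : iteratedDeriv n (fun t => f t - f (t + h)) t =
      iteratedDeriv n f t - iteratedDeriv n f (t + h) := by
    rw [iteratedDeriv_fun_sub, iteratedDeriv_comp_add_const]
    · exact (hf.contDiffAt ht).of_le (by exact_mod_cast le_top)
    · exact (hs t ht).of_le (by exact_mod_cast le_top)
  rw [h1, mul_sub, sub_nonneg]
  exact hf.antitoneOn n ht (show 0 < t + h by linarith) (by linarith)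

/-- Sampling starts at h and not at 0, where `f` may blow up. Each difference of the samples is a
sample of f(t) - f(t + h), again completely monotone. -/
theorem IsCompletelyMonotone.isCompletelyMonotoneSeq {f : ℝ → ℝ} (hf : IsCompletelyMonotone f)
    {h : ℝ} (hh : 0 < h) : IsCompletelyMonotoneSeq fun k => f ((k + 1) * h) := by
  intro n
  induction n generalizing f with
  | zero =>
    intro k
    simpa using hf.2 0 ((k + 1) * h) (by positivity)
  | succ n ih =>
    intro k
    rw [Function.iterate_succ_apply]
    convert ih (hf.sub_shift hh) k using 2
    ext i
    simp only [seqDiff]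
    push_cast
    ring_nf

/-- **Bernstein's theorem** on completely monotone functions. -/
theorem IsCompletelyMonotone.exists_measure {f : ℝ → ℝ} (hf : IsCompletelyMonotone f) :
    ∃ ρ : Measure ℝ, SFinite ρ ∧ ρ (Iio 0) = 0 ∧
      ∀ t : ℝ, 0 < t → ∫⁻ u, ENNReal.ofReal (Real.exp (-(u * t))) ∂ρ = ENNReal.ofReal (f t) := by
  have hm : ∀ m : ℕ, ∃ ν : Measure unitInterval, IsFiniteMeasure ν ∧
      ∀ k : ℕ, ∫ x, (x : ℝ) ^ k ∂ν = f ((k + 1) / (m + 1)) := by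
    intro m
    obtain ⟨ν, h1, h2⟩ :=
      (hf.isCompletelyMonotoneSeq (h := 1 / ((m : ℝ) + 1)) (by positivity)).exists_measure
    refine ⟨ν, h1, fun k => ?_⟩
    rw [h2, mul_one_div]
  choose ν hν hmom using hm
  have hnn : ∀ t : ℝ, 0 < t → 0 ≤ f t := fun t ht => by simpa using hf.2 0 t ht
  have hlin : ∀ m k : ℕ, ∫⁻ x, ENNReal.ofReal ((x : ℝ) ^ k) ∂(ν m) =
      ENNReal.ofReal (f ((k + 1) / (m + 1))) := by
    intro m k
    rw [← hmom m k, ofReal_integral_eq_lintegral_ofReal]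
    · exact (BoundedContinuousFunction.mkOfCompact
        ⟨fun x : unitInterval => (x : ℝ) ^ k, by fun_prop⟩).integrable _
    · exact Eventually.of_forall fun x => pow_nonneg x.2.1 _
  -- The offset in the sampling gives `ν m` an excess weight, corrected by the density xᵐ; the power
  -- map then carries mesh 1/(m + 1) to mesh 1. Equality of moments forces `κ m = ν 0`, so all
  -- meshes are governed by one measure.
  let κ : ℕ → Measure unitInterval := fun m =>
    ((ν m).withDensity fun x => ENNReal.ofReal ((x : ℝ) ^ m)).map fun x => x ^ (m + 1)
  have hmeas : ∀ k : ℕ, Measurable fun x : unitInterval => ENNReal.ofReal ((x : ℝ) ^ k) := by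
    intro k; fun_prop
  have hpm : ∀ k : ℕ, Measurable fun x : unitInterval => x ^ k := fun k =>
    (by fun_prop : Continuous fun x : unitInterval => x ^ k).measurable
  have hκ' : ∀ m (g : unitInterval → ENNReal), Measurable g → ∫⁻ y, g y ∂(κ m) =
      ∫⁻ x, ENNReal.ofReal ((x : ℝ) ^ m) * g (x ^ (m + 1)) ∂(ν m) := by
    intro m g hg
    rw [lintegral_map hg (hpm _)]
    exact lintegral_withDensity_eq_lintegral_mul _ (hmeas m) (hg.comp (hpm (m + 1)))
  have hκ : ∀ m, κ m = ν 0 := by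
    intro m
    have hk : ∀ k : ℕ, ∫⁻ y, ENNReal.ofReal ((y : ℝ) ^ k) ∂(κ m) =
        ∫⁻ y, ENNReal.ofReal ((y : ℝ) ^ k) ∂(ν 0) := by
      intro k
      rw [hκ' m _ (hmeas k), hlin 0 k]
      have : ∀ x : unitInterval, ENNReal.ofReal ((x : ℝ) ^ m) *
          ENNReal.ofReal (((x ^ (m + 1) : unitInterval) : ℝ) ^ k) =
          ENNReal.ofReal ((x : ℝ) ^ (m + (m + 1) * k)) := by
        intro x
        rw [← ENNReal.ofReal_mul (pow_nonneg x.2.1 _), pow_add (x : ℝ), pow_mul (x : ℝ)]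
        rfl
      simp only [this]
      rw [hlin m]
      congr 2
      push_cast
      field_simp
      ring
    have hfin : IsFiniteMeasure (κ m) := by
      constructor
      have := hk 0
      simp only [pow_zero, ENNReal.ofReal_one, lintegral_one] at this
      rw [this]; exact measure_lt_top _ _
    refine ext_of_forall_integral_pow_eq fun k => ?_
    rw [integral_eq_lintegral_of_nonneg_ae (Eventually.of_forall fun x => pow_nonneg x.2.1 _)
        (by fun_prop : Continuous fun x : unitInterval => (x : ℝ) ^ k).aestronglyMeasurable,
      integral_eq_lintegral_of_nonneg_ae (Eventually.of_forall fun x => pow_nonneg x.2.1 _)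
        (by fun_prop : Continuous fun x : unitInterval => (x : ℝ) ^ k).aestronglyMeasurable, hk k]
  let S : Set unitInterval := {x | 0 < (x : ℝ)}
  have hS : MeasurableSet S := measurableSet_lt measurable_const measurable_subtype_coe
  -- Substitution x = e^{-u}; the density 1/x undoes the offset, since the k-th moment of `ν 0` is
  -- f(k + 1).
  let ρ : Measure ℝ := (((ν 0).restrict S).withDensity fun x => ENNReal.ofReal ((x : ℝ)⁻¹)).map
    fun x : unitInterval => -Real.log x
  have hlog : Measurable fun x : unitInterval => -Real.log x :=
    (Real.measurable_log.comp measurable_subtype_coe).neg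
  have hρ : ∀ t : ℝ, ∫⁻ u, ENNReal.ofReal (Real.exp (-(u * t))) ∂ρ =
      ∫⁻ y in S, ENNReal.ofReal ((y : ℝ) ^ (t - 1)) ∂(ν 0) := by
    intro t
    have hg : Measurable fun u : ℝ => ENNReal.ofReal (Real.exp (-(u * t))) := by fun_prop
    rw [lintegral_map hg hlog]
    refine (lintegral_withDensity_eq_lintegral_mul _ (by fun_prop) (hg.comp hlog)).trans ?_
    refine setLIntegral_congr_fun hS fun y hy => ?_
    have hy : 0 < (y : ℝ) := hy
    simp only [Pi.mul_apply, Function.comp_apply]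
    rw [← ENNReal.ofReal_mul (by positivity), Real.rpow_sub_one hy.ne',
      Real.rpow_def_of_pos hy]
    congr 1
    rw [neg_mul, neg_neg]; field_simp
  have hρ0 : ρ (Iio 0) = 0 := by
    rw [Measure.map_apply hlog measurableSet_Iio]
    have : (fun x : unitInterval => -Real.log x) ⁻¹' Iio 0 = ∅ := by
      ext x
      simp only [mem_preimage, mem_Iio, mem_empty_iff_false, iff_false, not_lt, Left.nonneg_neg_iff]
      exact Real.log_nonpos x.2.1 x.2.2
    rw [this, measure_empty]
  -- Numerators are at least 2, so that the moment of `ν m` involved has positive order and does not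
  -- see a possible atom at 0.
  have hrat : ∀ m k : ℕ, ∫⁻ u, ENNReal.ofReal (Real.exp (-(u * ((k + 1 + 1) / (m + 1))))) ∂ρ =
      ENNReal.ofReal (f ((k + 1 + 1) / (m + 1))) := by
    intro m k
    have h1 := hlin m (k + 1)
    push_cast at h1
    rw [hρ, ← h1, ← hκ m, ← lintegral_indicator hS, hκ' m _ (Measurable.indicator (by fun_prop) hS)]
    refine lintegral_congr fun x => ?_
    have hx0 : 0 ≤ (x : ℝ) := x.2.1
    rcases hx0.eq_or_lt with hx | hx
    · have : x ^ (m + 1) ∉ S := by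
        simp only [S, mem_ofPred_eq, not_lt]
        change (x : ℝ) ^ (m + 1) ≤ 0
        rw [← hx]; simp
      rw [indicator_of_notMem this, ← hx]
      simp
    · have : x ^ (m + 1) ∈ S := by
        change 0 < (x : ℝ) ^ (m + 1)
        positivity
      rw [indicator_of_mem this, ← ENNReal.ofReal_mul (by positivity)]
      congr 1
      change (x : ℝ) ^ m * ((x : ℝ) ^ (m + 1)) ^ (((k : ℝ) + 1 + 1) / (m + 1) - 1) = _
      rw [← Real.rpow_natCast, ← Real.rpow_natCast, ← Real.rpow_natCast, ← Real.rpow_mul hx0,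
        ← Real.rpow_add hx]
      congr 1
      push_cast
      field_simp
      ring
  have hratpos : ∀ q : ℚ, 0 < q → ∫⁻ u, ENNReal.ofReal (Real.exp (-(u * (q : ℝ)))) ∂ρ =
      ENNReal.ofReal (f q) := by
    intro q hq
    obtain ⟨p, hp⟩ : ∃ p : ℕ, q.num = p + 1 := by
      have := Rat.num_pos.2 hq
      exact ⟨(q.num - 1).toNat, by omega⟩
    obtain ⟨d, hd⟩ : ∃ d : ℕ, q.den = d + 1 := ⟨q.den - 1, by have := q.den_pos; omega⟩
    -- Numerator and denominator are doubled to make the numerator at least 2.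
    have hqe : (q : ℝ) = (((2 * p : ℕ) : ℝ) + 1 + 1) / (((2 * d + 1 : ℕ) : ℝ) + 1) := by
      rw [Rat.cast_def, hp, hd]; push_cast; field_simp; ring
    rw [hqe]
    exact hrat _ _
  refine ⟨ρ, inferInstance, hρ0, fun t ht => ?_⟩
  -- Monotonicity of the transform and continuity of `f` extend the identity from rational to real
  -- t.
  have hF : Antitone fun t : ℝ => ∫⁻ u, ENNReal.ofReal (Real.exp (-(u * t))) ∂ρ := by
    intro a b hab
    refine lintegral_mono_ae ?_
    have : ∀ᵐ u ∂ρ, u ∉ Iio (0 : ℝ) := measure_eq_zero_iff_ae_notMem.1 hρ0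
    filter_upwards [this] with u hu
    have hu : 0 ≤ u := not_lt.1 hu
    gcongr
  have hcont : ContinuousAt (fun t => ENNReal.ofReal (f t)) t :=
    ENNReal.continuous_ofReal.continuousAt.comp (hf.contDiffAt ht).continuousAt
  refine le_antisymm ?_ ?_
  · obtain ⟨u, -, hu, hlim⟩ := Real.exists_seq_rat_strictMono_tendsto t
    refine ge_of_tendsto (hcont.tendsto.comp hlim) ?_
    filter_upwards [hlim.eventually (lt_mem_nhds ht)] with n hn
    exact (hF (hu n).le).trans_eq (hratpos _ (by exact_mod_cast hn))
  · obtain ⟨u, -, hu, hlim⟩ := Real.exists_seq_rat_strictAnti_tendsto t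
    refine le_of_tendsto (hcont.tendsto.comp hlim) (Eventually.of_forall fun n => ?_)
    exact (hratpos _ (by exact_mod_cast ht.trans (hu n))).symm.trans_le (hF (hu n).le)

/-! ### The Lévy–Khintchine representation and subadditivity. -/

/-- The Lévy kernel `∫₀ᵗ exp (-u s) ds`. -/
noncomputable def levyKernel (t u : ℝ) : ℝ := if u = 0 then t else (1 - Real.exp (-(u * t))) / u

theorem measurable_levyKernel : Measurable fun p : ℝ × ℝ => levyKernel p.1 p.2 := by
  unfold levyKernel
  exact Measurable.ite (measurableSet_eq_fun measurable_snd measurable_const) measurable_fst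
    (by fun_prop)

theorem levyKernel_zero_right (t : ℝ) : levyKernel t 0 = t := by simp [levyKernel]

theorem levyKernel_of_pos {t u : ℝ} (hu : 0 < u) :
    levyKernel t u = (1 - Real.exp (-(u * t))) / u := by simp [levyKernel, hu.ne']

theorem integral_exp_eq_levyKernel (t u : ℝ) :
    ∫ s in (0 : ℝ)..t, Real.exp (-(u * s)) = levyKernel t u := by
  rcases eq_or_ne u 0 with rfl | hu
  · simp [levyKernel_zero_right]
  · have hd : ∀ s ∈ uIcc 0 t, HasDerivAt (fun s => (1 - Real.exp (-(u * s))) / u)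
        (Real.exp (-(u * s))) s := by
      intro s _
      have h1 : HasDerivAt (fun s => -(u * s)) (-(u * 1)) s := ((hasDerivAt_id s).const_mul u).neg
      refine ((h1.exp.const_sub 1).div_const u).congr_deriv ?_
      field_simp
    rw [intervalIntegral.integral_eq_sub_of_hasDerivAt hd
      ((by fun_prop : Continuous fun s => Real.exp (-(u * s))).intervalIntegrable _ _)]
    simp [levyKernel, hu]

theorem lintegral_exp_eq_levyKernel {t : ℝ} (ht : 0 ≤ t) (u : ℝ) :
    ∫⁻ s in Ioc 0 t, ENNReal.ofReal (Real.exp (-(u * s))) = ENNReal.ofReal (levyKernel t u) := by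
  rw [← integral_exp_eq_levyKernel, intervalIntegral.integral_of_le ht,
    ofReal_integral_eq_lintegral_ofReal]
  · exact (by fun_prop : Continuous fun s => Real.exp (-(u * s))).integrableOn_Ioc
  · exact Eventually.of_forall fun s => (Real.exp_pos _).le

theorem levyKernel_nonneg {t : ℝ} (ht : 0 ≤ t) (u : ℝ) : 0 ≤ levyKernel t u := by
  rw [← integral_exp_eq_levyKernel]
  exact intervalIntegral.integral_nonneg ht fun s _ => (Real.exp_pos _).le

theorem levyKernel_add_le {s t u : ℝ} (hs : 0 ≤ s) (ht : 0 ≤ t) (hu : 0 ≤ u) :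
    levyKernel (s + t) u ≤ levyKernel s u + levyKernel t u := by
  have h : levyKernel (s + t) u = levyKernel s u + Real.exp (-(u * s)) * levyKernel t u := by
    unfold levyKernel
    split_ifs with h
    · simp [h]
    · rw [mul_add, neg_add, Real.exp_add]; field_simp; ring
  rw [h]
  gcongr
  exact mul_le_of_le_one_left (levyKernel_nonneg ht u)
    (Real.exp_le_one_iff.2 (neg_nonpos.2 (mul_nonneg hu hs)))

theorem levyKernel_le {t u : ℝ} (hu : 0 ≤ u) : levyKernel t u ≤ t := by
  rcases hu.eq_or_lt with rfl | hu
  · rw [levyKernel_zero_right]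
  · rw [levyKernel_of_pos hu, div_le_iff₀ hu]
    linarith [Real.add_one_le_exp (-(u * t))]

theorem tendsto_levyKernel (t : ℝ) : Tendsto (fun u => levyKernel t u) (𝓝[>] 0) (𝓝 t) := by
  have h1 : HasDerivAt (fun u => -(u * t)) (-(1 * t)) 0 := ((hasDerivAt_id (0 : ℝ)).mul_const t).neg
  have h2 : HasDerivAt (fun u => 1 - Real.exp (-(u * t))) t 0 :=
    (h1.exp.const_sub 1).congr_deriv (by simp)
  refine (h2.tendsto_slope.mono_left (nhdsWithin_mono _ fun x hx => ne_of_gt hx)).congr' ?_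
  filter_upwards [self_mem_nhdsWithin] with u hu
  rw [levyKernel_of_pos hu, slope_def_field]
  simp

/-- The **Lévy–Khintchine representation** of Bernstein functions. -/
theorem IsBernstein.exists_measure {ψ : ℝ → ℝ} (hψ : IsBernstein ψ) :
    ∃ ρ : Measure ℝ, SFinite ρ ∧ ρ (Iio 0) = 0 ∧ ∀ t : ℝ, 0 ≤ t →
      ∫⁻ u, ENNReal.ofReal (levyKernel t u) ∂ρ = ENNReal.ofReal (ψ t - ψ 0) := by
  obtain ⟨hc, hs, hcm⟩ := hψ
  obtain ⟨ρ, hρ, hρ0, hρf⟩ := hcm.exists_measure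
  refine ⟨ρ, hρ, hρ0, fun t ht => ?_⟩
  have hcont : ContinuousOn ψ (Icc 0 t) := hc.mono Icc_subset_Ici_self
  have hderiv : ∀ s ∈ Ioo 0 t, HasDerivAt ψ (deriv ψ s) s := fun s hs' =>
    ((hs.contDiffAt (Ioi_mem_nhds hs'.1)).differentiableAt (by simp)).hasDerivAt
  have hpos : ∀ s : ℝ, 0 < s → 0 ≤ deriv ψ s := fun s h => by simpa using hcm.2 0 s h
  have hint := intervalIntegral.integrableOn_deriv_of_nonneg hcont hderiv fun s h => hpos s h.1
  rw [← intervalIntegral.integral_eq_sub_of_hasDerivAt_of_le ht hcont hderiv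
    ((intervalIntegrable_iff_integrableOn_Ioc_of_le ht).2 hint), intervalIntegral.integral_of_le ht,
    ofReal_integral_eq_lintegral_ofReal hint
      ((ae_restrict_iff' measurableSet_Ioc).2 (Eventually.of_forall fun s h => hpos s h.1))]
  simp only [← lintegral_exp_eq_levyKernel ht]
  rw [lintegral_lintegral_swap (by fun_prop)]
  exact setLIntegral_congr_fun measurableSet_Ioc fun s h => hρf s h.1

/-- A Bernstein function with Lévy measure concentrated at the origin is affine. -/
theorem eq_add_mul_of_lintegral_levyKernel {ψ : ℝ → ℝ} {ρ : Measure ℝ} (h0 : ρ (Iio 0) = 0)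
    (h1 : ρ (Ioi 0) = 0) (hmono : ∀ t : ℝ, 0 ≤ t → ψ 0 ≤ ψ t)
    (h : ∀ t : ℝ, 0 ≤ t →
      ∫⁻ u, ENNReal.ofReal (levyKernel t u) ∂ρ = ENNReal.ofReal (ψ t - ψ 0)) :
    ∃ a b : ℝ, ∀ t : ℝ, 0 ≤ t → ψ t = a + b * t := by
  have hu : ∀ᵐ u ∂ρ, u = 0 := by
    filter_upwards [measure_eq_zero_iff_ae_notMem.1 h0, measure_eq_zero_iff_ae_notMem.1 h1]
      with u h2 h3
    exact le_antisymm (not_lt.1 h3) (not_lt.1 h2)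
  have ht : ∀ t : ℝ, 0 ≤ t → ENNReal.ofReal t * ρ univ = ENNReal.ofReal (ψ t - ψ 0) := by
    intro t ht
    rw [← h t ht, ← lintegral_const]
    refine lintegral_congr_ae ?_
    filter_upwards [hu] with u hu
    rw [hu, levyKernel_zero_right]
  refine ⟨ψ 0, (ρ univ).toReal, fun t h2 => ?_⟩
  have h3 := congrArg ENNReal.toReal (ht t h2)
  rw [ENNReal.toReal_mul, ENNReal.toReal_ofReal h2,
    ENNReal.toReal_ofReal (sub_nonneg.2 (hmono t h2))] at h3
  linarith

theorem IsBernstein.monotoneOn {ψ : ℝ → ℝ} (hψ : IsBernstein ψ) : MonotoneOn ψ (Ici 0) := by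
  refine monotoneOn_of_deriv_nonneg (convex_Ici 0) hψ.1 ?_ ?_
  · rw [interior_Ici]
    exact hψ.2.1.differentiableOn (by simp)
  · rw [interior_Ici]
    exact fun t ht => by simpa using hψ.2.2.2 0 t ht

/-- A Bernstein function is subadditive up to its value at the origin. -/
theorem IsBernstein.sub_add_le {ψ : ℝ → ℝ} (hψ : IsBernstein ψ) {s t : ℝ} (hs : 0 ≤ s)
    (ht : 0 ≤ t) : ψ (s + t) - ψ 0 ≤ (ψ s - ψ 0) + (ψ t - ψ 0) := by
  obtain ⟨ρ, -, hρ0, hρ⟩ := hψ.exists_measure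
  have hnn : ∀ t : ℝ, 0 ≤ t → 0 ≤ ψ t - ψ 0 := fun t ht =>
    sub_nonneg.2 (hψ.monotoneOn self_mem_Ici ht ht)
  have hm : ∀ t : ℝ, Measurable fun u => ENNReal.ofReal (levyKernel t u) := fun t =>
    (measurable_levyKernel.comp (measurable_const.prodMk measurable_id)).ennreal_ofReal
  rw [← ENNReal.ofReal_le_ofReal_iff (add_nonneg (hnn s hs) (hnn t ht)),
    ENNReal.ofReal_add (hnn s hs) (hnn t ht), ← hρ _ (add_nonneg hs ht), ← hρ s hs, ← hρ t ht,
    ← lintegral_add_left (hm s)]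
  refine lintegral_mono_ae ?_
  filter_upwards [measure_eq_zero_iff_ae_notMem.1 hρ0] with u hu
  have hu : 0 ≤ u := not_lt.1 hu
  rw [← ENNReal.ofReal_add (levyKernel_nonneg hs u) (levyKernel_nonneg ht u)]
  exact ENNReal.ofReal_le_ofReal (levyKernel_add_le hs ht hu)

/-! ### Positive semidefinite kernels and Schoenberg's theorem. -/

/-- **Moore–Aronszajn**: a real positive semidefinite kernel has a feature map. -/
theorem Matrix.PosSemidef.exists_featureMap {X : Type u} {K : Matrix X X ℝ} (hK : K.PosSemidef) :
    ∃ (H : Type u) (_ : NormedAddCommGroup H) (_ : InnerProductSpace ℝ H) (_ : CompleteSpace H)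
      (Φ : X → H), ∀ x y, ⟪Φ x, Φ y⟫ = K x y := by
  have hsymm : ∀ x y, K x y = K y x := fun x y => by simpa using hK.1.apply y x
  -- The scalar kernel is viewed as operator-valued, acting on ℝ by multiplication, to fit the
  -- vector-valued `RKHS` construction.
  let M : Matrix X X (ℝ →L[ℝ] ℝ) := fun x y => K x y • ContinuousLinearMap.id ℝ ℝ
  have hM : M.PosSemidef := by
    have h := (RKHS.posSemidef_tfae (K := M)).out 0 2
    refine h.2 ⟨Matrix.IsHermitian.ext fun x y => ?_, fun v => ?_⟩
    · simp only [M]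
      rw [ContinuousLinearMap.star_eq_adjoint, map_smulₛₗ, ContinuousLinearMap.adjoint_id, hsymm]
      simp
    · have := hK.2 v
      simp only [star_trivial, Finsupp.sum] at this
      simp only [M, Finsupp.sum, RCLike.re_to_real, _root_.smul_apply,
        ContinuousLinearMap.id_apply, smul_eq_mul, real_inner_eq_re_inner]
      refine this.trans_eq (Finset.sum_congr rfl fun x _ => Finset.sum_congr rfl fun y _ => ?_)
      rw [hsymm]
      simp
      ring
  have : Fact M.PosSemidef := ⟨hM⟩
  refine ⟨RKHS.OfKernel M, inferInstance, inferInstance, inferInstance,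
    fun x => RKHS.kerFun (RKHS.OfKernel M) x 1, fun x y => ?_⟩
  rw [← RKHS.kernel_inner, RKHS.OfKernel.kernel_ofKernel]
  simp [M, hsymm x y]

/-- Gram matrices are positive semidefinite. -/
theorem posSemidef_inner (H : Type*) [NormedAddCommGroup H] [InnerProductSpace ℝ H] :
    (Matrix.of fun x y : H => ⟪x, y⟫).PosSemidef := by
  refine ⟨by ext x y; simp [real_inner_comm], fun v => ?_⟩
  have : v.sum (fun x a => v.sum fun y b => star a * (Matrix.of fun x y : H => ⟪x, y⟫) x y * b) =
      ⟪v.sum fun x a => a • x, v.sum fun x a => a • x⟫ := by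
    simp only [Finsupp.sum, sum_inner, inner_sum, real_inner_smul_left, real_inner_smul_right]
    refine Finset.sum_congr rfl fun x _ => Finset.sum_congr rfl fun y _ => ?_
    simp only [star_trivial, Matrix.of_apply]
    rw [real_inner_comm x y]
    ring
  rw [this]
  exact real_inner_self_nonneg

/-- The Gaussian kernel of a real Hilbert space is positive semidefinite. -/
theorem posSemidef_gaussian (H : Type*) [NormedAddCommGroup H] [InnerProductSpace ℝ H] {u : ℝ}
    (hu : 0 ≤ u) : (Matrix.of fun x y : H => Real.exp (-(u * ‖x - y‖ ^ 2))).PosSemidef := by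
  refine ⟨by ext x y; simp [norm_sub_rev], fun v => ?_⟩
  have hpow : ∀ n : ℕ, (Matrix.of fun x y : H => ⟪x, y⟫ ^ n).PosSemidef := by
    intro n
    induction n with
    | zero =>
      refine ⟨by ext x y; simp, fun v => ?_⟩
      have : v.sum (fun x a => v.sum fun y b =>
          star a * (Matrix.of fun x y : H => ⟪x, y⟫ ^ 0) x y * b) =
          (v.sum fun x a => a) * (v.sum fun x a => a) := by
        simp [Finsupp.sum, Finset.sum_mul_sum]
      rw [this]
      exact mul_self_nonneg _
    | succ n ih =>
      have h : (Matrix.of fun x y : H => ⟪x, y⟫ ^ (n + 1)) =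
          (Matrix.of fun x y : H => ⟪x, y⟫ ^ n).hadamard (Matrix.of fun x y : H => ⟪x, y⟫) := by
        ext x y
        simp [pow_succ]
      rw [h]
      exact ih.hadamard (posSemidef_inner H)
  let c : H → ℝ := fun x => Real.exp (-(u * ‖x‖ ^ 2))
  -- The Gaussian is c(x) c(y) e^{2u⟪x, y⟫}; the exponential is expanded in powers of the inner
  -- product, each positive semidefinite by the Schur product theorem, and c is absorbed into the
  -- coefficients.
  have hterm : ∀ n : ℕ, 0 ≤ ∑ x ∈ v.support, ∑ y ∈ v.support,
      (c x * v x) * (c y * v y) * ((2 * u * ⟪x, y⟫) ^ n / n.factorial) := by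
    intro n
    let v' : H →₀ ℝ := Finsupp.onFinset v.support (fun x => c x * v x) (by
      intro x hx; simpa using right_ne_zero_of_mul hx)
    have h := (hpow n).2 v'
    have hs : v'.support ⊆ v.support := Finsupp.support_onFinset_subset
    rw [Finsupp.sum_of_support_subset _ hs _ (by simp)] at h
    have h2 : ∀ x, (v'.sum fun y b => star (v' x) * (Matrix.of fun x y : H => ⟪x, y⟫ ^ n) x y * b) =
        ∑ y ∈ v.support, star (v' x) * (Matrix.of fun x y : H => ⟪x, y⟫ ^ n) x y * v' y :=
      fun x => Finsupp.sum_of_support_subset _ hs _ (by simp)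
    simp only [h2] at h
    refine (mul_nonneg (by positivity : 0 ≤ (2 * u) ^ n / n.factorial) h).trans_eq ?_
    rw [Finset.mul_sum]
    refine Finset.sum_congr rfl fun x _ => ?_
    rw [Finset.mul_sum]
    refine Finset.sum_congr rfl fun y _ => ?_
    simp only [v', Finsupp.onFinset_apply, star_trivial, Matrix.of_apply, mul_pow]
    ring
  have hsum : HasSum (fun n : ℕ => ∑ x ∈ v.support, ∑ y ∈ v.support,
      (c x * v x) * (c y * v y) * ((2 * u * ⟪x, y⟫) ^ n / n.factorial))
      (∑ x ∈ v.support, ∑ y ∈ v.support, (c x * v x) * (c y * v y) * Real.exp (2 * u * ⟪x, y⟫)) := by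
    refine hasSum_sum fun x _ => hasSum_sum fun y _ => HasSum.mul_left _ ?_
    rw [Real.exp_eq_exp_ℝ]
    exact NormedSpace.expSeries_div_hasSum_exp _
  refine (hsum.nonneg hterm).trans_eq ?_
  refine Finset.sum_congr rfl fun x _ => Finset.sum_congr rfl fun y _ => ?_
  have : Real.exp (-(u * ‖x - y‖ ^ 2)) = c x * c y * Real.exp (2 * u * ⟪x, y⟫) := by
    simp only [c]
    rw [← Real.exp_add, ← Real.exp_add, norm_sub_sq_real]
    congr 1; ring
  simp only [Matrix.of_apply, star_trivial]
  rw [this]; ring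

/-- **Schoenberg**: a conditionally negative definite kernel is, up to additive diagonal terms, the
square of a Hilbertian distance. -/
theorem IsCND.exists_featureMap {X : Type u} {γ : X → X → ℝ} (hγ : IsCND γ) :
    ∃ (H : Type u) (_ : NormedAddCommGroup H) (_ : InnerProductSpace ℝ H) (_ : CompleteSpace H)
      (φ : X → H), ∀ x y, γ x y = ‖φ x - φ y‖ ^ 2 + γ x x / 2 + γ y y / 2 := by
  rcases isEmpty_or_nonempty X with hX | ⟨⟨z⟩⟩
  · obtain ⟨H, i1, i2, i3, φ, -⟩ :=
      (Matrix.PosSemidef.zero : (0 : Matrix X X ℝ).PosSemidef).exists_featureMap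
    exact ⟨H, i1, i2, i3, φ, fun x => hX.elim x⟩
  let K : Matrix X X ℝ := Matrix.of fun x y => (γ x z + γ y z - γ x y - γ z z) / 2
  have hK : K.PosSemidef := by
    refine ⟨?_, fun v => ?_⟩
    · ext x y; simp [K, hγ.1 x y]; ring
    · let n := v.support.card
      let e : Fin n ≃ v.support := v.support.equivFin.symm
      -- The base point z enters with coefficient -∑ v, which makes the coefficients sum to zero;
      -- the resulting form is -2 times that of `K`.
      have h := hγ.2 (n + 1) (Fin.cons z fun i => (e i : X))
        (Fin.cons (-∑ i, v (e i)) fun i => v (e i)) (by simp [Fin.sum_univ_succ])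
      simp only [Fin.sum_univ_succ, Fin.cons_zero, Fin.cons_succ] at h
      set S := ∑ i, v (e i) with hS
      clear_value S
      have hL : v.sum (fun x a => v.sum fun y b => star a * K x y * b) =
          ∑ i, ∑ j, v (e i) * K (e i) (e j) * v (e j) := by
        have hre : ∀ g : X → ℝ, ∑ x ∈ v.support, g x = ∑ i, g (e i) := fun g => by
          rw [← Finset.sum_coe_sort]
          exact (Equiv.sum_comp e fun x : v.support => g x).symm
        simp only [Finsupp.sum, hre, star_trivial]
      rw [hL]
      have hK' : ∑ i, ∑ j, v (e i) * K (e i) (e j) * v (e j) =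
          (S * ∑ i, v (e i) * γ (e i) z) - (∑ i, ∑ j, v (e i) * v (e j) * γ (e i) (e j)) / 2
            - S * S * γ z z / 2 := by
        have h1 : S * S = ∑ i, ∑ j, v (e i) * v (e j) := by rw [hS, Finset.sum_mul_sum]
        have h2 : S * ∑ i, v (e i) * γ (e i) z = ∑ i, ∑ j, v (e j) * (v (e i) * γ (e i) z) := by
          rw [Finset.mul_sum]
          refine Finset.sum_congr rfl fun i _ => ?_
          rw [hS, Finset.sum_mul]
        have h3 : S * ∑ i, v (e i) * γ (e i) z = ∑ i, ∑ j, v (e i) * (v (e j) * γ (e j) z) := by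
          rw [h2, Finset.sum_comm]
        have h4 : S * ∑ i, v (e i) * γ (e i) z =
            ((S * ∑ i, v (e i) * γ (e i) z) + (S * ∑ i, v (e i) * γ (e i) z)) / 2 := by ring
        rw [h4]
        nth_rw 1 [h2]
        rw [h3, h1, Finset.sum_mul, ← Finset.sum_add_distrib]
        simp only [Finset.sum_mul, ← Finset.sum_add_distrib, Finset.sum_div,
          ← Finset.sum_sub_distrib]
        refine Finset.sum_congr rfl fun i _ => Finset.sum_congr rfl fun j _ => ?_
        simp only [K, Matrix.of_apply]; ring
      rw [hK']
      have e1 : ∑ j, -S * v (e j) * γ z (e j) = -(S * ∑ i, v (e i) * γ (e i) z) := by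
        rw [Finset.mul_sum, ← Finset.sum_neg_distrib]
        exact Finset.sum_congr rfl fun i _ => by rw [hγ.1 z (e i)]; ring
      have e2 : ∑ i, (v (e i) * -S * γ (e i) z + ∑ j, v (e i) * v (e j) * γ (e i) (e j)) =
          -(S * ∑ i, v (e i) * γ (e i) z) + ∑ i, ∑ j, v (e i) * v (e j) * γ (e i) (e j) := by
        rw [Finset.sum_add_distrib, Finset.mul_sum, ← Finset.sum_neg_distrib]
        congr 1
        exact Finset.sum_congr rfl fun i _ => by ring
      rw [e1, e2] at h
      linarith
  obtain ⟨H, i1, i2, i3, φ, hφ⟩ := hK.exists_featureMap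
  refine ⟨H, i1, i2, i3, φ, fun x y => ?_⟩
  rw [norm_sub_sq_real, ← real_inner_self_eq_norm_sq, ← real_inner_self_eq_norm_sq, hφ, hφ, hφ]
  simp only [K, Matrix.of_apply]
  ring

/-- A squared distance satisfies the triangle inequality up to a factor 2; the diagonal terms only
help because they are nonnegative. -/
theorem IsCND.le_two_mul_add {X : Type*} {γ : X → X → ℝ} (hγ : IsCND γ)
    (hnn : ∀ x y, 0 ≤ γ x y) (x y z : X) : γ x y ≤ 2 * γ x z + 2 * γ z y := by
  obtain ⟨H, _, _, _, φ, hφ⟩ := hγ.exists_featureMap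
  rw [hφ x y, hφ x z, hφ z y]
  have h1 : ‖φ x - φ y‖ ≤ ‖φ x - φ z‖ + ‖φ z - φ y‖ := norm_sub_le_norm_sub_add_norm_sub ..
  have h2 : ‖φ x - φ y‖ ^ 2 ≤ (‖φ x - φ z‖ + ‖φ z - φ y‖) ^ 2 := by gcongr
  nlinarith [sq_nonneg (‖φ x - φ z‖ - ‖φ z - φ y‖), hnn x x, hnn y y, hnn z z]

theorem continuous_of_norm_sub_sq {X H : Type*} [TopologicalSpace X] [NormedAddCommGroup H]
    {φ : X → H} (h : Continuous fun p : X × X => ‖φ p.1 - φ p.2‖ ^ 2) : Continuous φ := by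
  rw [continuous_iff_continuousAt]
  intro x
  rw [ContinuousAt, tendsto_iff_norm_sub_tendsto_zero]
  have h1 : Tendsto (fun y => ‖φ y - φ x‖ ^ 2) (𝓝 x) (𝓝 0) := by
    have := (h.comp (continuous_id.prodMk continuous_const : Continuous fun y => (y, x))).tendsto x
    simpa [Function.comp_def] using this
  simpa [Function.comp_def, Real.sqrt_sq (norm_nonneg _)] using (Real.continuous_sqrt.tendsto 0).comp h1

theorem continuous_of_inner {X H : Type*} [TopologicalSpace X] [NormedAddCommGroup H]
    [InnerProductSpace ℝ H] {φ : X → H} (h : Continuous fun p : X × X => ⟪φ p.1, φ p.2⟫) :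
    Continuous φ := by
  refine continuous_of_norm_sub_sq ?_
  simp_rw [norm_sub_sq_real, ← real_inner_self_eq_norm_sq]
  have h1 : ∀ g : X × X → X, Continuous g → Continuous fun p => ⟪φ (g p), φ (g p)⟫ := fun g hg =>
    h.comp (hg.prodMk hg)
  exact ((h1 _ continuous_fst).sub (h.const_mul 2)).add (h1 _ continuous_snd)

/-! ### Inner regular measures and strong measurability. -/

section

variable {X : Type*} [TopologicalSpace X] [T2Space X] [MeasurableSpace X] [BorelSpace X]

/-- An inner regular finite measure is concentrated on a countable union of compact sets. -/
theorem exists_seq_isCompact_measure_compl_iUnion (m : Measure X) [IsFiniteMeasure m]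
    [m.InnerRegularCompactLTTop] :
    ∃ K : ℕ → Set X, (∀ n, IsCompact (K n)) ∧ m (⋃ n, K n)ᶜ = 0 := by
  have h : ∀ n : ℕ, ∃ K : Set X, IsCompact K ∧ m Kᶜ < ((n : ENNReal) + 1)⁻¹ := by
    intro n
    obtain ⟨K, -, hK, hlt⟩ := MeasurableSet.univ.exists_isCompact_sdiff_lt (μ := m)
      (measure_ne_top _ _) (ε := ((n : ENNReal) + 1)⁻¹) (by simp)
    exact ⟨K, hK, by rwa [compl_eq_univ_sdiff]⟩
  choose K hK hlt using h
  refine ⟨K, hK, ?_⟩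
  have hlim : Tendsto (fun n : ℕ => ((n : ENNReal) + 1)⁻¹) atTop (𝓝 0) := by
    have := (tendsto_add_atTop_iff_nat 1).2 ENNReal.tendsto_inv_nat_nhds_zero
    simpa using this
  refine le_antisymm (ge_of_tendsto' hlim fun n => ?_) bot_le
  exact (measure_mono (compl_subset_compl.2 (subset_iUnion K n))).trans (hlt n).le

/-- The target may be nonseparable, but the measure lives on a σ-compact set, whose image is
separable. -/
theorem Continuous.aestronglyMeasurable_of_innerRegular {H : Type*} [TopologicalSpace H]
    [TopologicalSpace.PseudoMetrizableSpace H] {φ : X → H}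
    (hφ : Continuous φ) (m : Measure X) [IsFiniteMeasure m] [m.InnerRegularCompactLTTop] :
    AEStronglyMeasurable φ m := by
  borelize H
  obtain ⟨K, hK, h0⟩ := exists_seq_isCompact_measure_compl_iUnion m
  refine aestronglyMeasurable_iff_aemeasurable_separable.2 ⟨hφ.measurable.aemeasurable,
    ⋃ n, φ '' K n, .iUnion fun n => ((hK n).image hφ).isSeparable, ?_⟩
  filter_upwards [measure_eq_zero_iff_ae_notMem.1 h0] with x hx
  rw [notMem_compl_iff, mem_iUnion] at hx
  obtain ⟨n, hn⟩ := hx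
  exact mem_iUnion.2 ⟨n, mem_image_of_mem φ hn⟩

end

/-! ### Gaussian energies as squared norms. -/

section

variable {X H : Type*} [MeasurableSpace X] [NormedAddCommGroup H] [InnerProductSpace ℝ H]

theorem MeasureTheory.Integrable.integral_prod_inner [CompleteSpace H] {m : Measure X} [SFinite m] {Ψ : X → H}
    (hΨ : Integrable Ψ m) :
    ∫ p : X × X, ⟪Ψ p.1, Ψ p.2⟫ ∂(m.prod m) = ‖∫ x, Ψ x ∂m‖ ^ 2 := by
  have hint : Integrable (fun p : X × X => ⟪Ψ p.1, Ψ p.2⟫) (m.prod m) := by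
    refine (hΨ.norm.mul_prod hΨ.norm).mono' (hΨ.1.comp_fst.inner hΨ.1.comp_snd)
      (Eventually.of_forall fun p => norm_inner_le_norm _ _)
  rw [integral_prod _ hint]
  simp only [integral_inner hΨ, real_inner_comm (∫ x, Ψ x ∂m)]
  rw [← real_inner_self_eq_norm_sq, ← integral_inner hΨ]

/-- The Gaussian energy of a signed density is nonnegative, and the potential of a density of
energy zero vanishes everywhere. -/
theorem gaussian_energy_nonneg {φ : X → H} {m : Measure X} [IsFiniteMeasure m]
    (hφ : AEStronglyMeasurable φ m)
    {a : X → ℝ} (ha : Integrable a m) {u : ℝ} (hu : 0 ≤ u) :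
    0 ≤ ∫ p : X × X, a p.1 * a p.2 * Real.exp (-(u * ‖φ p.1 - φ p.2‖ ^ 2)) ∂(m.prod m) ∧
      (∫ p : X × X, a p.1 * a p.2 * Real.exp (-(u * ‖φ p.1 - φ p.2‖ ^ 2)) ∂(m.prod m) = 0 →
        ∀ h : H, ∫ x, a x * Real.exp (-(u * ‖φ x - h‖ ^ 2)) ∂m = 0) := by
  obtain ⟨E, _, _, _, Φ, hΦ⟩ := (posSemidef_gaussian H hu).exists_featureMap
  simp only [Matrix.of_apply] at hΦ
  have hΦc : Continuous Φ := continuous_of_inner (by simp only [hΦ]; fun_prop)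
  have hΦ1 : ∀ h, ‖Φ h‖ = 1 := fun h => by
    have := hΦ h h
    rw [real_inner_self_eq_norm_sq] at this
    simp only [sub_self, norm_zero, ne_eq, OfNat.ofNat_ne_zero, not_false_eq_true, zero_pow,
      mul_zero, neg_zero, Real.exp_zero] at this
    exact (pow_eq_one_iff_of_nonneg (norm_nonneg _) two_ne_zero).1 this
  have hint : Integrable (fun x => a x • Φ (φ x)) m :=
    ha.norm.mono' (ha.1.smul (hΦc.comp_aestronglyMeasurable hφ)) (Eventually.of_forall fun x => by
      rw [norm_smul, hΦ1, mul_one])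
  have hI : ∫ p : X × X, a p.1 * a p.2 * Real.exp (-(u * ‖φ p.1 - φ p.2‖ ^ 2)) ∂(m.prod m) =
      ‖∫ x, a x • Φ (φ x) ∂m‖ ^ 2 := by
    rw [← hint.integral_prod_inner]
    refine integral_congr_ae (Eventually.of_forall fun p => ?_)
    simp only [real_inner_smul_left, real_inner_smul_right, hΦ]
    ring
  rw [hI]
  refine ⟨sq_nonneg _, fun h0 h => ?_⟩
  have h1 : ∫ x, a x • Φ (φ x) ∂m = 0 := by simpa using h0
  have h2 := integral_inner (𝕜 := ℝ) hint (Φ h)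
  rw [h1, inner_zero_right] at h2
  refine Eq.trans (integral_congr_ae (Eventually.of_forall fun x => ?_)) h2
  simp only [real_inner_smul_right]
  rw [hΦ, norm_sub_rev]

end

/-! ### Uniqueness from exponential integrals. -/

section

open ProbabilityTheory

variable {X : Type*} [MeasurableSpace X]

/-- Finite measures with all exponential moments finite and equal moment generating functions have
the same characteristic functional. -/
theorem integral_cexp_eq_of_mgf_eq {Y : X → ℝ} {P P' : Measure X} [IsFiniteMeasure P]
    [IsFiniteMeasure P'] (hint : ∀ t : ℝ, Integrable (fun x => Real.exp (t * Y x)) P)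
    (h : ∀ t : ℝ, ∫ x, Real.exp (t * Y x) ∂P = ∫ x, Real.exp (t * Y x) ∂P') :
    ∫ x, Complex.exp (Y x * Complex.I) ∂P = ∫ x, Complex.exp (Y x * Complex.I) ∂P' := by
  have hzero : P = 0 ↔ P' = 0 := by
    have := h 0
    simp only [zero_mul, Real.exp_zero, integral_const, smul_eq_mul, mul_one] at this
    rw [← Measure.measure_univ_eq_zero, ← Measure.measure_univ_eq_zero,
      ← measureReal_eq_zero_iff, ← measureReal_eq_zero_iff, this]
  have hset : integrableExpSet Y P = univ := eq_univ_of_forall hint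
  -- With all exponential moments finite, equality of the real transforms continues analytically to
  -- ℂ; it is read off at z = i.
  have key := eqOn_complexMGF_of_mgf' (X := Y) (Y := Y) (μ := P) (μ' := P') (funext h) hzero
  rw [hset, interior_univ] at key
  have := key (mem_univ Complex.I : Complex.I ∈ {z : ℂ | z.re ∈ univ})
  simpa only [complexMGF, mul_comm Complex.I] using this

variable [TopologicalSpace X] [T2Space X] [BorelSpace X] {H : Type*} [NormedAddCommGroup H]
  [InnerProductSpace ℝ H] [CompleteSpace H]

/-- Inner regular finite measures on a Hausdorff space are determined by their characteristic
functional along an injective continuous map into a Hilbert space. -/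
theorem ext_of_integral_cexp_eq {φ : X → H} (hφ : Continuous φ) (hinj : Function.Injective φ)
    {P P' : Measure X} [IsFiniteMeasure P] [IsFiniteMeasure P'] [P.InnerRegularCompactLTTop]
    [P'.InnerRegularCompactLTTop]
    (h : ∀ v : H, ∫ x, Complex.exp (⟪φ x, v⟫ * Complex.I) ∂P =
      ∫ x, Complex.exp (⟪φ x, v⟫ * Complex.I) ∂P') : P = P' := by
  obtain ⟨K, hK, hK0⟩ := exists_seq_isCompact_measure_compl_iUnion P
  obtain ⟨K', hK', hK0'⟩ := exists_seq_isCompact_measure_compl_iUnion P'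
  let S : Set X := (⋃ n, K n) ∪ ⋃ n, K' n
  have hS : MeasurableSet S := (MeasurableSet.iUnion fun n => (hK n).measurableSet).union
    (MeasurableSet.iUnion fun n => (hK' n).measurableSet)
  have hPS : P Sᶜ = 0 := measure_mono_null (compl_subset_compl.2 subset_union_left) hK0
  have hPS' : P' Sᶜ = 0 := measure_mono_null (compl_subset_compl.2 subset_union_right) hK0'
  -- A closed separable subspace containing the image of a σ-compact set carrying both measures:
  -- uniqueness of characteristic functions applies there, and injectivity of φ brings equality back
  -- on compact subsets of `S`.
  let W : Submodule ℝ H := (Submodule.span ℝ (φ '' S)).topologicalClosure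
  have hsep : TopologicalSpace.IsSeparable (W : Set H) := by
    refine TopologicalSpace.IsSeparable.closure (TopologicalSpace.IsSeparable.span ?_)
    rw [image_union, image_iUnion, image_iUnion]
    exact (TopologicalSpace.IsSeparable.iUnion fun n => ((hK n).image hφ).isSeparable).union
      (TopologicalSpace.IsSeparable.iUnion fun n => ((hK' n).image hφ).isSeparable)
  have : TopologicalSpace.SeparableSpace W := hsep.separableSpace
  have : SecondCountableTopology W := UniformSpace.secondCountable_of_separable W
  have : CompleteSpace W := (Submodule.isClosed_topologicalClosure _).completeSpace_coe
  borelize ↥W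
  let π : X → W := fun x => W.orthogonalProjectionOnto (φ x)
  have hπ : Continuous π := W.orthogonalProjectionOnto.continuous.comp hφ
  have hmem : ∀ x ∈ S, φ x ∈ W := fun x hx =>
    Submodule.le_topologicalClosure _ (Submodule.subset_span (mem_image_of_mem φ hx))
  have hπS : ∀ x ∈ S, (π x : H) = φ x := fun x hx =>
    congrArg ((↑) : W → H) (W.orthogonalProjectionOnto_mem_subspace_eq_self ⟨φ x, hmem x hx⟩)
  have hmap : P.map π = P'.map π := by
    refine Measure.ext_of_charFun (funext fun w => ?_)
    rw [charFun_apply, charFun_apply, integral_map hπ.measurable.aemeasurable (by fun_prop),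
      integral_map hπ.measurable.aemeasurable (by fun_prop)]
    have hin : ∀ x, ⟪π x, w⟫ = ⟪φ x, (w : H)⟫ := fun x =>
      Submodule.inner_orthogonalProjectionOnto_eq_of_mem_right w (φ x)
    simp only [hin]
    exact h w
  have hcomp : ∀ C : Set X, IsCompact C → C ⊆ S → P C = P' C := by
    intro C hC hCS
    have hm : MeasurableSet (π '' C) := (hC.image hπ).measurableSet
    have hpre : π ⁻¹' (π '' C) ∩ S = C := by
      ext x
      refine ⟨?_, fun hx => ⟨mem_image_of_mem π hx, hCS hx⟩⟩
      rintro ⟨⟨y, hy, hyx⟩, hxS⟩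
      have : φ y = φ x := by rw [← hπS y (hCS hy), ← hπS x hxS, hyx]
      rwa [← hinj this]
    have h1 : ∀ m : Measure X, m Sᶜ = 0 → m.map π (π '' C) = m C := by
      intro m hm0
      rw [Measure.map_apply hπ.measurable hm, ← measure_inter_add_sdiff _ hS, hpre,
        measure_mono_null (sdiff_subset_compl _ _) hm0, add_zero]
    rw [← h1 P hPS, ← h1 P' hPS', hmap]
  have hle : ∀ (A : Set X), MeasurableSet A → A ⊆ S → P A = P' A := by
    intro A hA hAS
    rw [hA.measure_eq_iSup_isCompact_of_ne_top (measure_ne_top P A),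
      hA.measure_eq_iSup_isCompact_of_ne_top (measure_ne_top P' A)]
    exact iSup_congr fun C => iSup_congr fun hC => iSup_congr fun hCc => hcomp C hCc (hC.trans hAS)
  ext A hA
  have h1 : ∀ m : Measure X, m Sᶜ = 0 → m A = m (A ∩ S) := by
    intro m hm0
    rw [← measure_inter_add_sdiff A hS, measure_mono_null (sdiff_subset_compl _ _) hm0, add_zero]
  rw [h1 P hPS, h1 P' hPS', hle _ (hA.inter hS) inter_subset_right]

end

/-! ### Densities with vanishing Gaussian potential. -/

section

variable {X : Type*} [TopologicalSpace X] [T2Space X] [MeasurableSpace X] [BorelSpace X]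

/-- Compact sets exhausting A up to an `m`-null set also exhaust it up to an `m'`-null set;
continuity from below finishes. -/
theorem MeasureTheory.Measure.AbsolutelyContinuous.innerRegularCompactLTTop {m m' : Measure X}
    [IsFiniteMeasure m] [IsFiniteMeasure m'] [m.InnerRegularCompactLTTop] (h : m' ≪ m) :
    m'.InnerRegularCompactLTTop := by
  refine ⟨fun A hA' r hr => ?_⟩
  have hA := hA'.1
  have hex : ∀ n : ℕ, ∃ K ⊆ A, IsCompact K ∧ m (A \ K) < ((n : ENNReal) + 1)⁻¹ := fun n =>
    hA.exists_isCompact_sdiff_lt (measure_ne_top _ _) (by simp)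
  choose K hKA hK hlt using hex
  have hlim : Tendsto (fun n : ℕ => ((n : ENNReal) + 1)⁻¹) atTop (𝓝 0) := by
    have := (tendsto_add_atTop_iff_nat 1).2 ENNReal.tendsto_inv_nat_nhds_zero
    simpa using this
  have h0 : m' (A \ ⋃ n, K n) = 0 := by
    refine h (le_antisymm (ge_of_tendsto' hlim fun n => ?_) bot_le)
    exact (measure_mono (sdiff_subset_sdiff_right (subset_iUnion K n))).trans (hlt n).le
  have h1 : m' A ≤ m' (⋃ n, accumulate K n) := by
    rw [iUnion_accumulate]
    calc m' A ≤ m' ((⋃ n, K n) ∪ (A \ ⋃ n, K n)) := measure_mono (by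
          intro x hx; by_cases hx' : x ∈ ⋃ n, K n
          · exact Or.inl hx'
          · exact Or.inr ⟨hx, hx'⟩)
      _ ≤ m' (⋃ n, K n) + m' (A \ ⋃ n, K n) := measure_union_le _ _
      _ = m' (⋃ n, K n) := by rw [h0, add_zero]
  rw [monotone_accumulate.measure_iUnion] at h1
  obtain ⟨n, hn⟩ := lt_iSup_iff.1 (hr.trans_le h1)
  exact ⟨accumulate K n, iUnion₂_subset fun i _ => hKA i, isCompact_accumulate hK n, hn⟩

variable {H : Type*} [NormedAddCommGroup H] [InnerProductSpace ℝ H] [CompleteSpace H]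

/-- A density whose Gaussian potential vanishes identically is zero. -/
theorem ae_eq_zero_of_gaussian_potential_eq_zero {φ : X → H} (hφ : Continuous φ)
    (hinj : Function.Injective φ) {m : Measure X} [IsFiniteMeasure m] [m.InnerRegularCompactLTTop]
    {a : X → ℝ} (ha : Integrable a m) {u : ℝ} (hu : 0 < u)
    (h : ∀ v : H, ∫ x, a x * Real.exp (-(u * ‖φ x - v‖ ^ 2)) ∂m = 0) : a =ᵐ[m] 0 := by
  let b : X → ℝ := fun x => a x * Real.exp (-(u * ‖φ x‖ ^ 2))
  -- Completing the square: the centre v/(2u) makes the cross term exactly ⟪φ x, v⟫.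
  have hexp : ∀ v x, Real.exp ⟪φ x, v⟫ * b x =
      Real.exp (‖v‖ ^ 2 / (4 * u)) * (a x * Real.exp (-(u * ‖φ x - (2 * u)⁻¹ • v‖ ^ 2))) := by
    intro v x
    have : Real.exp ⟪φ x, v⟫ * Real.exp (-(u * ‖φ x‖ ^ 2)) =
        Real.exp (‖v‖ ^ 2 / (4 * u)) * Real.exp (-(u * ‖φ x - (2 * u)⁻¹ • v‖ ^ 2)) := by
      rw [← Real.exp_add, ← Real.exp_add, norm_sub_sq_real, real_inner_smul_right, norm_smul,
        mul_pow, Real.norm_eq_abs, sq_abs]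
      congr 1
      field_simp
      ring
    simp only [b]
    linear_combination a x * this
  have hmeas : ∀ v : H, AEStronglyMeasurable (fun x => Real.exp (-(u * ‖φ x - v‖ ^ 2))) m :=
    fun v => (by fun_prop : Continuous fun x => Real.exp (-(u * ‖φ x - v‖ ^ 2))).aestronglyMeasurable
  have hint : ∀ v : H, Integrable (fun x => Real.exp ⟪φ x, v⟫ * b x) m := by
    intro v
    simp only [hexp]
    refine Integrable.const_mul ?_ _
    refine ha.norm.mono' (ha.1.mul (hmeas _)) (Eventually.of_forall fun x => ?_)
    rw [norm_mul, Real.norm_of_nonneg (Real.exp_pos _).le]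
    exact mul_le_of_le_one_right (norm_nonneg _)
      (Real.exp_le_one_iff.2 (neg_nonpos.2 (by positivity)))
  have hb : Integrable b m := by simpa using hint 0
  have hzero : ∀ v : H, ∫ x, Real.exp ⟪φ x, v⟫ * b x ∂m = 0 := by
    intro v
    simp only [hexp]
    rw [integral_const_mul, h, mul_zero]
  have hd : ∀ c : X → ℝ, Integrable c m → AEMeasurable (fun x => ENNReal.ofReal (c x)) m :=
    fun c hc => hc.1.aemeasurable.ennreal_ofReal
  have hfin : ∀ c : X → ℝ, Integrable c m →
      IsFiniteMeasure (m.withDensity fun x => ENNReal.ofReal (c x)) := fun c hc =>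
    isFiniteMeasure_withDensity_ofReal hc.2
  have hreg : ∀ c : X → ℝ, Integrable c m →
      (m.withDensity fun x => ENNReal.ofReal (c x)).InnerRegularCompactLTTop := fun c hc =>
    have := hfin c hc
    (withDensity_absolutelyContinuous m _).innerRegularCompactLTTop
  -- The positive and negative parts of b have the same Laplace transform, hence coincide; having
  -- disjoint supports, both vanish.
  let P := m.withDensity fun x => ENNReal.ofReal (b x)
  let P' := m.withDensity fun x => ENNReal.ofReal (-b x)
  have : IsFiniteMeasure P := hfin b hb
  have : IsFiniteMeasure P' := hfin _ hb.neg
  have : P.InnerRegularCompactLTTop := hreg b hb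
  have : P'.InnerRegularCompactLTTop := hreg _ hb.neg
  have hI : ∀ c : X → ℝ, Integrable c m → ∀ v,
      ∫ x, Real.exp ⟪φ x, v⟫ ∂(m.withDensity fun x => ENNReal.ofReal (c x)) =
        ∫ x, max (c x) 0 * Real.exp ⟪φ x, v⟫ ∂m := by
    intro c hc v
    rw [integral_withDensity_eq_integral_toReal_smul₀ (hd c hc)
      (Eventually.of_forall fun x => ENNReal.ofReal_lt_top)]
    simp only [ENNReal.toReal_ofReal', smul_eq_mul]
  have hPint : ∀ v, Integrable (fun x => Real.exp ⟪φ x, v⟫) P := by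
    intro v
    rw [integrable_withDensity_iff_integrable_smul₀' (hd b hb)
      (Eventually.of_forall fun x => ENNReal.ofReal_lt_top)]
    refine (hint v).norm.mono' ?_ (Eventually.of_forall fun x => ?_)
    · exact (hd b hb).ennreal_toReal.aestronglyMeasurable.smul
        (by fun_prop : Continuous fun x => Real.exp ⟪φ x, v⟫).aestronglyMeasurable
    · rw [ENNReal.toReal_ofReal', norm_smul, norm_mul, mul_comm]
      gcongr
      rw [Real.norm_of_nonneg (le_max_right _ _)]
      exact max_le (le_abs_self _) (abs_nonneg _)
  have hPP : P = P' := by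
    refine ext_of_integral_cexp_eq hφ hinj fun v => ?_
    refine integral_cexp_eq_of_mgf_eq (fun t => ?_) fun t => ?_
    · simpa only [real_inner_smul_right] using hPint (t • v)
    · have h1 : ∀ x, t * ⟪φ x, v⟫ = ⟪φ x, t • v⟫ := fun x => (real_inner_smul_right _ _ _).symm
      simp only [h1]
      rw [hI b hb, hI (fun x => -b x) hb.neg, ← sub_eq_zero, ← integral_sub]
      · refine Eq.trans (integral_congr_ae (Eventually.of_forall fun x => ?_)) (hzero (t • v))
        simp only
        rw [← sub_mul, mul_comm]
        congr 1
        rcases le_total 0 (b x) with hx | hx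
        · rw [max_eq_left hx, max_eq_right (by linarith), sub_zero]
        · rw [max_eq_right hx, max_eq_left (by linarith)]; ring
      all_goals
        refine (hint (t • v)).norm.mono' ?_ (Eventually.of_forall fun x => ?_)
        · refine AEStronglyMeasurable.mul ?_
            (by fun_prop : Continuous fun x => Real.exp ⟪φ x, t • v⟫).aestronglyMeasurable
          first
          | exact hb.1.sup aestronglyMeasurable_const
          | exact hb.neg.1.sup aestronglyMeasurable_const
        · rw [norm_mul, norm_mul, mul_comm]
          gcongr
          rw [Real.norm_of_nonneg (le_max_right _ _)]
          first
          | exact max_le (le_abs_self _) (abs_nonneg _)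
          | exact max_le (neg_le_abs _) (abs_nonneg _)
  have hae := (withDensity_eq_iff_of_sigmaFinite (hd b hb) (hd _ hb.neg)).1 hPP
  filter_upwards [hae] with x hx
  have hbx : b x = 0 := by
    have hx' : ENNReal.ofReal (b x) = ENNReal.ofReal (-b x) := hx
    rcases le_total 0 (b x) with h0 | h0
    · rw [ENNReal.ofReal_of_nonpos (neg_nonpos.2 h0), ENNReal.ofReal_eq_zero] at hx'
      exact le_antisymm hx' h0
    · rw [ENNReal.ofReal_of_nonpos h0, eq_comm, ENNReal.ofReal_eq_zero] at hx'
      linarith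
  exact (mul_eq_zero.1 hbx).resolve_right (Real.exp_pos _).ne'

end

/-! ### Energies of neutral densities. -/

section

variable {X : Type*} [TopologicalSpace X] [T2Space X] [MeasurableSpace X] [BorelSpace X]
  {γ : X → X → ℝ}

theorem IsCND.exists_continuous_featureMap {X : Type u} [TopologicalSpace X] {γ : X → X → ℝ}
    (hγ : IsCND γ) (hc : Continuous fun p : X × X => γ p.1 p.2) :
    ∃ (H : Type u) (_ : NormedAddCommGroup H) (_ : InnerProductSpace ℝ H) (_ : CompleteSpace H)
      (φ : X → H), Continuous φ ∧ ∀ x y, γ x y = ‖φ x - φ y‖ ^ 2 + γ x x / 2 + γ y y / 2 := by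
  obtain ⟨H, i1, i2, i3, φ, hφ⟩ := hγ.exists_featureMap
  refine ⟨H, i1, i2, i3, φ, continuous_of_norm_sub_sq ?_, hφ⟩
  have h : (fun p : X × X => ‖φ p.1 - φ p.2‖ ^ 2) =
      fun p : X × X => γ p.1 p.2 - γ p.1 p.1 / 2 - γ p.2 p.2 / 2 := by
    ext p
    rw [hφ p.1 p.2]; ring
  rw [h]
  have h1 : ∀ g : X × X → X, Continuous g → Continuous fun p => γ (g p) (g p) := fun g hg =>
    hc.comp (hg.prodMk hg)
  exact (hc.sub ((h1 _ continuous_fst).div_const 2)).sub ((h1 _ continuous_snd).div_const 2)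

/-- The Borel σ-algebra of X × X may exceed the product one, so continuity of γ is not enough; the
formula through φ separates the variables. -/
theorem IsCND.aemeasurable_prod (hγ : IsCND γ) (hc : Continuous fun p : X × X => γ p.1 p.2)
    (m m' : Measure X) [IsFiniteMeasure m] [IsFiniteMeasure m'] [m.InnerRegularCompactLTTop]
    [m'.InnerRegularCompactLTTop] : AEMeasurable (fun p : X × X => γ p.1 p.2) (m.prod m') := by
  obtain ⟨H, _, _, _, φ, hφc, hφ⟩ := hγ.exists_continuous_featureMap hc
  have h : (fun p : X × X => γ p.1 p.2) =
      fun p : X × X => ‖φ p.1 - φ p.2‖ ^ 2 + γ p.1 p.1 / 2 + γ p.2 p.2 / 2 := by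
    ext p
    exact hφ p.1 p.2
  rw [h]
  have hd : Measurable fun x => γ x x / 2 :=
    ((hc.comp (continuous_id.prodMk continuous_id)).div_const 2).measurable
  have hn : AEStronglyMeasurable (fun p : X × X => ‖φ p.1 - φ p.2‖ ^ 2) (m.prod m') :=
    ((((hφc.aestronglyMeasurable_of_innerRegular m).comp_fst).sub
      ((hφc.aestronglyMeasurable_of_innerRegular m').comp_snd)).norm).pow 2
  exact (hn.aemeasurable.add (hd.comp measurable_fst).aemeasurable).add
    (hd.comp measurable_snd).aemeasurable

variable {m : Measure X} [IsFiniteMeasure m] [m.InnerRegularCompactLTTop] {s : X → ℝ}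

/-- Integral form of Schoenberg's theorem, with the case of equality. -/
theorem IsCND.exp_energy_nonneg (hγ : IsCND γ) (hc : Continuous fun p : X × X => γ p.1 p.2)
    (hnn : ∀ x y, 0 ≤ γ x y) (hs : Integrable s m) {u : ℝ} (hu : 0 ≤ u) :
    0 ≤ ∫ p : X × X, s p.1 * s p.2 * Real.exp (-(u * γ p.1 p.2)) ∂(m.prod m) ∧
      (0 < u → (∀ x y, 2 * γ x y = γ x x + γ y y → x = y) →
        ∫ p : X × X, s p.1 * s p.2 * Real.exp (-(u * γ p.1 p.2)) ∂(m.prod m) = 0 →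
        s =ᵐ[m] 0) := by
  obtain ⟨H, _, _, _, φ, hφc, hφ⟩ := hγ.exists_continuous_featureMap hc
  -- The diagonal terms of γ are moved into the density, leaving a pure Gaussian kernel.
  let a : X → ℝ := fun x => s x * Real.exp (-(u * (γ x x / 2)))
  have hd : Continuous fun x => γ x x := hc.comp (continuous_id.prodMk continuous_id)
  have ha : Integrable a m := by
    refine hs.norm.mono' (hs.1.mul (by fun_prop :
      Continuous fun x => Real.exp (-(u * (γ x x / 2)))).aestronglyMeasurable)
      (Eventually.of_forall fun x => ?_)
    rw [norm_mul, Real.norm_of_nonneg (Real.exp_pos _).le]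
    refine mul_le_of_le_one_right (norm_nonneg _) (Real.exp_le_one_iff.2 (neg_nonpos.2 ?_))
    have := hnn x x
    positivity
  have hI : ∀ p : X × X, s p.1 * s p.2 * Real.exp (-(u * γ p.1 p.2)) =
      a p.1 * a p.2 * Real.exp (-(u * ‖φ p.1 - φ p.2‖ ^ 2)) := by
    intro p
    have : Real.exp (-(u * γ p.1 p.2)) = Real.exp (-(u * (γ p.1 p.1 / 2))) *
        Real.exp (-(u * (γ p.2 p.2 / 2))) * Real.exp (-(u * ‖φ p.1 - φ p.2‖ ^ 2)) := by
      rw [← Real.exp_add, ← Real.exp_add, hφ p.1 p.2]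
      congr 1; ring
    rw [this]; simp only [a]; ring
  simp only [hI]
  obtain ⟨h1, h2⟩ :=
    gaussian_energy_nonneg (hφc.aestronglyMeasurable_of_innerRegular m) ha hu
  refine ⟨h1, fun hu' hinj h0 => ?_⟩
  have hφi : Function.Injective φ := by
    intro x y hxy
    refine hinj x y ?_
    rw [hφ x y, hxy]
    simp; ring
  filter_upwards [ae_eq_zero_of_gaussian_potential_eq_zero hφc hφi ha hu' (h2 h0)] with x hx
  exact (mul_eq_zero.1 hx).resolve_right (Real.exp_pos _).ne'

theorem integral_prod_mul_mul_const {Y : Type*} [MeasurableSpace Y] {m : Measure Y} [SFinite m]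
    {s : Y → ℝ} (hs0 : ∫ x, s x ∂m = 0) (c : ℝ) :
    ∫ p : Y × Y, s p.1 * s p.2 * c ∂(m.prod m) = 0 := by
  rw [integral_mul_const, integral_prod_mul, hs0, zero_mul, zero_mul]

theorem MeasureTheory.Integrable.mul_mul_of_abs_le_one {Y : Type*} [MeasurableSpace Y]
    {m : Measure Y} {s : Y → ℝ}
    [SFinite m] (hs : AEStronglyMeasurable s m) (hs1 : ∀ x, |s x| ≤ 1) {F : Y × Y → ℝ}
    (hF : Integrable F (m.prod m)) :
    Integrable (fun p : Y × Y => s p.1 * s p.2 * F p) (m.prod m) := by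
  refine hF.norm.mono' ((hs.comp_fst.mul hs.comp_snd).mul hF.1) (Eventually.of_forall fun p => ?_)
  rw [norm_mul, norm_mul]
  refine mul_le_of_le_one_left (norm_nonneg _) ?_
  exact mul_le_one₀ (hs1 _) (norm_nonneg _) (hs1 _)

/-- Energies of neutral densities with respect to Lévy kernels. -/
theorem IsCND.levyKernel_energy (hγ : IsCND γ) (hc : Continuous fun p : X × X => γ p.1 p.2)
    (hnn : ∀ x y, 0 ≤ γ x y) (hs : Integrable s m) (hs1 : ∀ x, |s x| ≤ 1) (hs0 : ∫ x, s x ∂m = 0)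
    {u : ℝ} (hu : 0 < u) :
    -∫ p : X × X, s p.1 * s p.2 * levyKernel (γ p.1 p.2) u ∂(m.prod m) =
      u⁻¹ * ∫ p : X × X, s p.1 * s p.2 * Real.exp (-(u * γ p.1 p.2)) ∂(m.prod m) := by
  have he : Integrable (fun p : X × X => Real.exp (-(u * γ p.1 p.2))) (m.prod m) := by
    refine Integrable.of_bound
      ((hγ.aemeasurable_prod hc m m).const_mul u).neg.exp.aestronglyMeasurable 1
      (Eventually.of_forall fun p => ?_)
    rw [Real.norm_of_nonneg (Real.exp_pos _).le]
    exact Real.exp_le_one_iff.2 (neg_nonpos.2 (mul_nonneg hu.le (hnn _ _)))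
  have h1 : ∀ p : X × X, s p.1 * s p.2 * levyKernel (γ p.1 p.2) u =
      s p.1 * s p.2 * u⁻¹ - u⁻¹ * (s p.1 * s p.2 * Real.exp (-(u * γ p.1 p.2))) := by
    intro p
    rw [levyKernel_of_pos hu]; field_simp
  simp only [h1]
  rw [integral_sub ((integrable_const _).mul_mul_of_abs_le_one hs.1 hs1)
    ((he.mul_mul_of_abs_le_one hs.1 hs1).const_mul _), integral_prod_mul_mul_const hs0,
    integral_const_mul]
  ring

theorem IsCND.levyKernel_energy_nonneg (hγ : IsCND γ)
    (hc : Continuous fun p : X × X => γ p.1 p.2)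
    (hnn : ∀ x y, 0 ≤ γ x y) (hs : Integrable s m) (hs1 : ∀ x, |s x| ≤ 1) (hs0 : ∫ x, s x ∂m = 0)
    {u : ℝ} (hu : 0 ≤ u)
    (hint : Integrable (fun p : X × X => s p.1 * s p.2 * levyKernel (γ p.1 p.2) u) (m.prod m)) :
    0 ≤ -∫ p : X × X, s p.1 * s p.2 * levyKernel (γ p.1 p.2) u ∂(m.prod m) := by
  have hpos : ∀ u : ℝ, 0 < u →
      0 ≤ -∫ p : X × X, s p.1 * s p.2 * levyKernel (γ p.1 p.2) u ∂(m.prod m) := fun u hu => by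
    rw [hγ.levyKernel_energy hc hnn hs hs1 hs0 hu]
    exact mul_nonneg (inv_nonneg.2 hu.le) (hγ.exp_energy_nonneg hc hnn hs hu.le).1
  rcases hu.eq_or_lt with rfl | hu
  · simp only [levyKernel_zero_right] at hint ⊢
    have hγm := hγ.aemeasurable_prod hc m m
    -- The drift case u = 0 is a limit of positive u, dominated because L(t, u) ≤ t.
    have hlim : Tendsto (fun u => ∫ p : X × X, s p.1 * s p.2 * levyKernel (γ p.1 p.2) u ∂(m.prod m))
        (𝓝[>] 0) (𝓝 (∫ p : X × X, s p.1 * s p.2 * γ p.1 p.2 ∂(m.prod m))) := by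
      refine tendsto_integral_filter_of_dominated_convergence
        (fun p => ‖s p.1 * s p.2 * γ p.1 p.2‖) (Eventually.of_forall fun u => ?_) ?_ hint.norm
        (Eventually.of_forall fun p => (tendsto_levyKernel _).const_mul _)
      · exact (hs.1.comp_fst.mul hs.1.comp_snd).mul
          (measurable_levyKernel.comp_aemeasurable
            (hγm.prodMk aemeasurable_const)).aestronglyMeasurable
      · filter_upwards [self_mem_nhdsWithin] with u hu
        refine Eventually.of_forall fun p => ?_
        rw [norm_mul (s p.1 * s p.2), norm_mul (s p.1 * s p.2)]
        refine mul_le_mul_of_nonneg_left ?_ (norm_nonneg _)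
        rw [Real.norm_of_nonneg (levyKernel_nonneg (hnn _ _) u), Real.norm_of_nonneg (hnn _ _)]
        exact levyKernel_le (le_of_lt hu)
    refine ge_of_tendsto hlim.neg ?_
    filter_upwards [self_mem_nhdsWithin] with u hu
    exact hpos u hu
  · exact hpos u hu

/-- Bernstein functions of conditionally negative definite kernels have nonnegative energy on
neutral densities, with equality only for the zero density in the strict case. -/
theorem IsCND.bernstein_energy_nonneg (hγ : IsCND γ)
    (hc : Continuous fun p : X × X => γ p.1 p.2)
    (hnn : ∀ x y, 0 ≤ γ x y) (hs : Integrable s m) (hs1 : ∀ x, |s x| ≤ 1) (hs0 : ∫ x, s x ∂m = 0)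
    {ψ : ℝ → ℝ} (hψ : IsBernstein ψ)
    (hint : Integrable (fun p : X × X => ψ (γ p.1 p.2)) (m.prod m)) :
    0 ≤ -∫ p : X × X, s p.1 * s p.2 * ψ (γ p.1 p.2) ∂(m.prod m) ∧
      ((¬ ∃ a b : ℝ, ∀ t : ℝ, 0 ≤ t → ψ t = a + b * t) →
        (∀ x y, 2 * γ x y = γ x x + γ y y → x = y) →
        -∫ p : X × X, s p.1 * s p.2 * ψ (γ p.1 p.2) ∂(m.prod m) = 0 → s =ᵐ[m] 0) := by
  obtain ⟨ρ, _, hρ0, hρ⟩ := hψ.exists_measure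
  have hmono : ∀ t : ℝ, 0 ≤ t → ψ 0 ≤ ψ t := fun t ht => hψ.monotoneOn self_mem_Ici ht ht
  have hρae : ∀ᵐ u ∂ρ, 0 ≤ u := by
    filter_upwards [measure_eq_zero_iff_ae_notMem.1 hρ0] with u hu using not_lt.1 hu
  have hγm := hγ.aemeasurable_prod hc m m
  let F : (X × X) × ℝ → ℝ := fun q => s q.1.1 * s q.1.2 * levyKernel (γ q.1.1 q.1.2) q.2
  have hL : AEMeasurable (fun q : (X × X) × ℝ => levyKernel (γ q.1.1 q.1.2) q.2)
      ((m.prod m).prod ρ) :=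
    measurable_levyKernel.comp_aemeasurable
      ((hγm.comp_quasiMeasurePreserving Measure.quasiMeasurePreserving_fst).prodMk
        measurable_snd.aemeasurable)
  have hFm : AEStronglyMeasurable F ((m.prod m).prod ρ) :=
    ((hs.1.comp_fst.mul hs.1.comp_snd).comp_fst).mul hL.aestronglyMeasurable
  have hψ0 : Integrable (fun p : X × X => ψ (γ p.1 p.2) - ψ 0) (m.prod m) :=
    hint.sub (integrable_const _)
  -- By Tonelli, the integral of L over u is ψ(γ) - ψ(0), so integrability of ψ(γ) is exactly what
  -- Fubini needs.
  have hLint : Integrable (fun q : (X × X) × ℝ => levyKernel (γ q.1.1 q.1.2) q.2)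
      ((m.prod m).prod ρ) := by
    refine ⟨hL.aestronglyMeasurable, ?_⟩
    rw [hasFiniteIntegral_iff_ofReal
      (Eventually.of_forall fun q => levyKernel_nonneg (hnn _ _) _), lintegral_prod _ hL.ennreal_ofReal]
    simp only [hρ _ (hnn _ _)]
    exact (hasFiniteIntegral_iff_ofReal
      (Eventually.of_forall fun p => sub_nonneg.2 (hmono _ (hnn _ _)))).1 hψ0.2
  have hF : Integrable F ((m.prod m).prod ρ) := by
    refine hLint.norm.mono' hFm (Eventually.of_forall fun q => ?_)
    simp only [F]
    rw [norm_mul, norm_mul]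
    exact mul_le_of_le_one_left (norm_nonneg _) (mul_le_one₀ (hs1 _) (norm_nonneg _) (hs1 _))
  let J : ℝ → ℝ := fun u => -∫ p : X × X, s p.1 * s p.2 * levyKernel (γ p.1 p.2) u ∂(m.prod m)
  have hinner : ∀ t : ℝ, 0 ≤ t → ∫ u, levyKernel t u ∂ρ = ψ t - ψ 0 := by
    intro t ht
    rw [integral_eq_lintegral_of_nonneg_ae (Eventually.of_forall fun u => levyKernel_nonneg ht u)
      (measurable_levyKernel.comp (measurable_const.prodMk measurable_id)).aestronglyMeasurable,
      hρ t ht, ENNReal.toReal_ofReal (sub_nonneg.2 (hmono t ht))]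
  have hJ : ∫ u, J u ∂ρ = -∫ p : X × X, s p.1 * s p.2 * ψ (γ p.1 p.2) ∂(m.prod m) := by
    have h1 : ∫ u, ∫ p : X × X, F (p, u) ∂(m.prod m) ∂ρ = ∫ p : X × X, ∫ u, F (p, u) ∂ρ ∂(m.prod m) := by
      rw [integral_integral_swap]
      exact hF.swap
    simp only [J]
    rw [integral_neg]
    congr 1
    refine h1.trans ?_
    have h2 : ∀ p : X × X, ∫ u, F (p, u) ∂ρ =
        s p.1 * s p.2 * ψ (γ p.1 p.2) - s p.1 * s p.2 * ψ 0 := by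
      intro p
      simp only [F]
      rw [integral_const_mul, hinner _ (hnn _ _)]; ring
    simp only [h2]
    rw [integral_sub (hint.mul_mul_of_abs_le_one hs.1 hs1)
      ((integrable_const _).mul_mul_of_abs_le_one hs.1 hs1), integral_prod_mul_mul_const hs0,
      sub_zero]
  have hJnn : 0 ≤ᵐ[ρ] J := by
    filter_upwards [hρae, hF.prod_left_ae] with u hu hFu
    exact hγ.levyKernel_energy_nonneg hc hnn hs hs1 hs0 hu hFu
  rw [← hJ]
  refine ⟨integral_nonneg_of_ae hJnn, fun haff hinj h0 => ?_⟩
  have hJint : Integrable J ρ := hF.integral_prod_right.neg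
  have hJ0 := (integral_eq_zero_iff_of_nonneg_ae hJnn hJint).1 h0
  -- For a nonzero density J(u) ≠ 0 at every u > 0; since J = 0 almost everywhere, ρ would be
  -- concentrated at 0 and ψ affine.
  by_contra hne
  refine haff (eq_add_mul_of_lintegral_levyKernel hρ0 ?_ hmono hρ)
  refine measure_eq_zero_iff_ae_notMem.2 ?_
  filter_upwards [hJ0] with u hu hu0
  have hu0 : 0 < u := hu0
  simp only [J, Pi.zero_apply] at hu
  rw [hγ.levyKernel_energy hc hnn hs hs1 hs0 hu0] at hu
  exact hne ((hγ.exp_energy_nonneg hc hnn hs hu0.le).2 hu0 hinj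
    ((mul_eq_zero.1 hu).resolve_left (inv_pos.2 hu0).ne'))

end

/-! ### Signed measures as unimodular densities. -/

section SignedMeasure

variable {X : Type*} [MeasurableSpace X]

theorem ContinuousLinearMap.flip_lsmul_real :
    (ContinuousLinearMap.lsmul ℝ ℝ : ℝ →L[ℝ] ℝ →L[ℝ] ℝ).flip = ContinuousLinearMap.lsmul ℝ ℝ := by
  ext
  simp

/-- Polar decomposition of a signed measure: its integral has a density of absolute value one with
respect to the total variation. -/
theorem MeasureTheory.SignedMeasure.exists_sign (μ : SignedMeasure X) :
    ∃ s : X → ℝ, Measurable s ∧ (∀ x, |s x| = 1) ∧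
      ∀ f : X → ℝ, Integrable f μ.totalVariation →
        ∫ᵛ x, f x ∂•μ = ∫ x, s x * f x ∂μ.totalVariation := by
  classical
  set j := μ.toJordanDecomposition with hj
  obtain ⟨A, hA, hpos, hneg⟩ := j.mutuallySingular
  -- The set A is null for the positive part and its complement is null for the negative part, hence
  -- the sign -1 on A.
  refine ⟨fun x => if x ∈ A then -1 else 1, Measurable.ite hA measurable_const measurable_const,
    fun x => by dsimp only; split_ifs <;> simp, fun f hf => ?_⟩
  have hf1 : Integrable f j.posPart := hf.mono_measure (Measure.le_add_right le_rfl)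
  have hf2 : Integrable f j.negPart := hf.mono_measure (Measure.le_add_left le_rfl)
  have hp : ∀ᵐ x ∂j.posPart, x ∉ A := measure_eq_zero_iff_ae_notMem.1 hpos
  have hn : ∀ᵐ x ∂j.negPart, x ∈ A := by
    filter_upwards [measure_eq_zero_iff_ae_notMem.1 hneg] with x hx using not_not.1 hx
  have e1 : (fun x => (if x ∈ A then (-1 : ℝ) else 1) * f x) =ᵐ[j.posPart] f := by
    filter_upwards [hp] with x hx
    simp [hx]
  have e2 : (fun x => (if x ∈ A then (-1 : ℝ) else 1) * f x) =ᵐ[j.negPart] fun x => -f x := by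
    filter_upwards [hn] with x hx
    simp [hx]
  have h1 : μ = j.posPart.toSignedMeasure - j.negPart.toSignedMeasure :=
    μ.toSignedMeasure_toJordanDecomposition.symm
  have h2 : ∫ x, (if x ∈ A then (-1 : ℝ) else 1) * f x ∂μ.totalVariation =
      ∫ x, f x ∂j.posPart - ∫ x, f x ∂j.negPart := by
    rw [SignedMeasure.totalVariation, ← hj,
      integral_add_measure (hf1.congr e1.symm) (hf2.neg.congr e2.symm), integral_congr_ae e1,
      integral_congr_ae e2, integral_neg, sub_eq_add_neg]
  rw [h2, h1, VectorMeasure.integral_sub_vectorMeasure 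
      (by rwa [VectorMeasure.Integrable, Measure.variation_toSignedMeasure])
      (by rwa [VectorMeasure.Integrable, Measure.variation_toSignedMeasure]),
    ← ContinuousLinearMap.flip_lsmul_real, VectorMeasure.integral_toSignedMeasure,
    VectorMeasure.integral_toSignedMeasure]

theorem MeasureTheory.SignedMeasure.totalVariation_add_le (μ ν : SignedMeasure X) :
    (μ + ν).totalVariation ≤ μ.totalVariation + ν.totalVariation := by
  simpa only [SignedMeasure.totalVariation_eq_variation] using
    VectorMeasure.variation_add_le

theorem MeasureTheory.SignedMeasure.totalVariation_smul (c : ℝ) (μ : SignedMeasure X) :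
    (c • μ).totalVariation = ‖c‖₊ • μ.totalVariation := by
  simpa only [SignedMeasure.totalVariation_eq_variation] using VectorMeasure.variation_smul

theorem MeasureTheory.SignedMeasure.eq_zero_of_totalVariation_eq_zero {μ : SignedMeasure X}
    (h : μ.totalVariation = 0) : μ = 0 := by
  rwa [SignedMeasure.totalVariation_eq_variation, VectorMeasure.variation_eq_zero] at h

variable {ψ : ℝ → ℝ} {γ : X → X → ℝ} {μ ν : SignedMeasure X} {s t : X → ℝ}

theorem integral_sign_eq {Y : Type*} [MeasurableSpace Y] {μ : SignedMeasure Y} {s : Y → ℝ}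
    (hμ : ∀ f : Y → ℝ, Integrable f μ.totalVariation →
      ∫ᵛ x, f x ∂•μ = ∫ x, s x * f x ∂μ.totalVariation) :
    ∫ x, s x ∂μ.totalVariation = μ Set.univ := by
  have : IsFiniteMeasure μ.variation := by
    rw [← SignedMeasure.totalVariation_eq_variation]; infer_instance
  have h := hμ (fun _ => 1) (integrable_const _)
  rw [VectorMeasure.integral_const] at h
  simpa using h.symm

/-- Unimodular densities preserve integrability on products. -/
theorem MeasureTheory.Integrable.sign_mul_prod {Y : Type*} [MeasurableSpace Y] {m m' : Measure Y}
    [SFinite m] [SFinite m'] {s t : Y → ℝ} (hs : Measurable s) (ht : Measurable t)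
    (hs1 : ∀ x, |s x| = 1) (ht1 : ∀ x, |t x| = 1) {F : Y × Y → ℝ} (hF : Integrable F (m.prod m')) :
    Integrable (fun p : Y × Y => s p.1 * t p.2 * F p) (m.prod m') := by
  refine hF.norm.mono' (((hs.comp measurable_fst).mul
    (ht.comp measurable_snd)).aestronglyMeasurable.mul hF.1) (Eventually.of_forall fun p => ?_)
  rw [norm_mul, norm_mul, Real.norm_eq_abs (s _), Real.norm_eq_abs (t _), hs1, ht1, one_mul,
    one_mul]

theorem integrable_potential (hμ : ∀ z, Integrable (fun x => ψ (γ x z)) μ.totalVariation)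
    (hint : Integrable (fun p : X × X => ψ (γ p.1 p.2))
      (μ.totalVariation.prod ν.totalVariation)) :
    Integrable (fun y => ∫ᵛ x, ψ (γ x y) ∂•μ) ν.totalVariation := by
  obtain ⟨s, hs, hs1, hsμ⟩ := μ.exists_sign
  have h := (hint.sign_mul_prod hs (measurable_const (a := (1 : ℝ))) hs1
    (fun _ => abs_one)).integral_prod_right
  refine h.congr (Eventually.of_forall fun y => ?_)
  simp only [mul_one]
  exact (hsμ _ (hμ y)).symm

theorem energyForm_eq_integral (hμ : ∀ z, Integrable (fun x => ψ (γ x z)) μ.totalVariation)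
    (hint : Integrable (fun p : X × X => ψ (γ p.1 p.2))
      (μ.totalVariation.prod ν.totalVariation))
    (hs : Measurable s) (ht : Measurable t)
    (hs1 : ∀ x, |s x| = 1) (ht1 : ∀ x, |t x| = 1)
    (hsμ : ∀ f : X → ℝ, Integrable f μ.totalVariation →
      ∫ᵛ x, f x ∂•μ = ∫ x, s x * f x ∂μ.totalVariation)
    (htν : ∀ f : X → ℝ, Integrable f ν.totalVariation →
      ∫ᵛ x, f x ∂•ν = ∫ x, t x * f x ∂ν.totalVariation) :
    energyForm γ ψ μ ν = -∫ p : X × X, s p.1 * t p.2 * ψ (γ p.1 p.2)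
      ∂(μ.totalVariation.prod ν.totalVariation) := by
  rw [energyForm, htν _ (integrable_potential hμ hint),
    integral_prod_symm _ (hint.sign_mul_prod hs ht hs1 ht1)]
  congr 2
  ext y
  rw [hsμ _ (hμ y), ← integral_const_mul]
  congr 1
  ext x
  ring

end SignedMeasure

/-! ### Growth and integrability of Bernstein functions. -/

section Bernstein

variable {ψ : ℝ → ℝ}

theorem IsBernstein.sub_le_two_mul_add (hψ : IsBernstein ψ) {r a b : ℝ} (hr : 0 ≤ r)
    (ha : 0 ≤ a) (hb : 0 ≤ b) (h : r ≤ 2 * a + 2 * b) :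
    ψ r - ψ 0 ≤ 2 * (ψ a - ψ 0) + 2 * (ψ b - ψ 0) := by
  have h1 : ψ r ≤ ψ ((a + a) + (b + b)) :=
    hψ.monotoneOn hr (show (0 : ℝ) ≤ (a + a) + (b + b) by positivity) (by linarith)
  have h2 := hψ.sub_add_le (add_nonneg ha ha) (add_nonneg hb hb)
  have h3 := hψ.sub_add_le ha ha
  have h4 := hψ.sub_add_le hb hb
  linarith

theorem IsBernstein.continuous_comp {Y : Type*} [TopologicalSpace Y] (hψ : IsBernstein ψ)
    {g : Y → ℝ} (hg : Continuous g) (hnn : ∀ y, 0 ≤ g y) : Continuous fun y => ψ (g y) :=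
  hψ.1.comp_continuous hg hnn

theorem IsBernstein.aestronglyMeasurable_comp {Y : Type*} [MeasurableSpace Y] {m : Measure Y}
    (hψ : IsBernstein ψ) {g : Y → ℝ} (hg : AEMeasurable g m) (hnn : ∀ y, 0 ≤ g y) :
    AEStronglyMeasurable (fun y => ψ (g y)) m := by
  -- Nothing is known about ψ on the negative axis, so it is truncated there.
  have h1 : Continuous fun t : ℝ => ψ (max t 0) :=
    hψ.continuous_comp (by fun_prop) fun t => le_max_right _ _
  have h2 : (fun y => ψ (g y)) = fun y => ψ (max (g y) 0) := by
    ext y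
    rw [max_eq_left (hnn y)]
  rw [h2]
  exact (h1.measurable.comp_aemeasurable hg).aestronglyMeasurable

/-- Membership in `L¹` may be tested after subtracting the value at zero, with a nonnegative
majorant. -/
theorem IsBernstein.integrable_comp_of_le {Y : Type*} [MeasurableSpace Y] {m : Measure Y}
    [IsFiniteMeasure m] (hψ : IsBernstein ψ) {g : Y → ℝ} (hnn : ∀ y, 0 ≤ g y)
    (hg : AEStronglyMeasurable (fun y => ψ (g y)) m) {F : Y → ℝ} (hF : Integrable F m)
    (hle : ∀ y, ψ (g y) - ψ 0 ≤ F y) : Integrable (fun y => ψ (g y)) m := by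
  have h : Integrable (fun y => ψ (g y) - ψ 0) m := by
    refine hF.mono' (hg.sub aestronglyMeasurable_const) (Eventually.of_forall fun y => ?_)
    rw [Real.norm_of_nonneg (sub_nonneg.2 (hψ.monotoneOn self_mem_Ici (hnn y) (hnn y)))]
    exact hle y
  exact (h.add (integrable_const (ψ 0))).congr
    (Eventually.of_forall fun y => sub_add_cancel _ _)

end Bernstein

/-! ### The space of neutral measures of finite energy. -/

section Energy

variable {X : Type*} [TopologicalSpace X] [MeasurableSpace X] [BorelSpace X] {ψ : ℝ → ℝ}
  {γ : X → X → ℝ}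

/-- Fubini supplies one point w with integrable section; the weak triangle inequality transfers this
to every z. -/
theorem IsCND.integrable_section (hψ : IsBernstein ψ) (hγ : IsCND γ)
    (hc : Continuous fun p : X × X => γ p.1 p.2) (hnn : ∀ x y, 0 ≤ γ x y) {m : Measure X}
    [IsFiniteMeasure m] (h : Integrable (fun p : X × X => ψ (γ p.1 p.2)) (m.prod m)) (z : X) :
    Integrable (fun x => ψ (γ x z)) m := by
  rcases eq_or_ne m 0 with rfl | hm
  · simp
  have : (ae m).NeBot := ae_neBot.2 hm
  obtain ⟨w, hw⟩ := h.prod_left_ae.exists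
  have hcz : Continuous fun x => γ x z := hc.comp (continuous_id.prodMk continuous_const)
  refine hψ.integrable_comp_of_le (fun x => hnn x z)
    (hψ.continuous_comp hcz fun x => hnn x z).measurable.aestronglyMeasurable
    (((hw.sub (integrable_const (ψ 0))).const_mul 2).add
      (integrable_const (2 * (ψ (γ w z) - ψ 0)))) fun x => ?_
  exact hψ.sub_le_two_mul_add (hnn _ _) (hnn _ _) (hnn _ _) (hγ.le_two_mul_add hnn x z w)

variable [T2Space X]

theorem isRadonMeasure_iff_innerRegularCompactLTTop {m : Measure X} [IsFiniteMeasure m] :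
    IsRadonMeasure m ↔ m.InnerRegularCompactLTTop :=
  ⟨fun h => have := h.2.1; inferInstance,
    fun _ => ⟨inferInstance, inferInstance, inferInstance⟩⟩

theorem IsCND.integrable_prod (hψ : IsBernstein ψ) (hγ : IsCND γ)
    (hc : Continuous fun p : X × X => γ p.1 p.2) (hnn : ∀ x y, 0 ≤ γ x y) {m m' : Measure X}
    [IsFiniteMeasure m] [IsFiniteMeasure m'] [m.InnerRegularCompactLTTop]
    [m'.InnerRegularCompactLTTop] (h : ∀ z, Integrable (fun x => ψ (γ x z)) m)
    (h' : ∀ z, Integrable (fun x => ψ (γ x z)) m') :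
    Integrable (fun p : X × X => ψ (γ p.1 p.2)) (m.prod m') := by
  rcases isEmpty_or_nonempty X with hX | ⟨⟨z⟩⟩
  · exact Integrable.of_isEmpty
  refine hψ.integrable_comp_of_le (fun p => hnn p.1 p.2)
    (hψ.aestronglyMeasurable_comp (hγ.aemeasurable_prod hc m m') fun p => hnn p.1 p.2)
    ((((h z).sub (integrable_const (ψ 0))).const_mul 2).comp_fst m' |>.add
      ((((h' z).sub (integrable_const (ψ 0))).const_mul 2).comp_snd m)) fun p => ?_
  refine hψ.sub_le_two_mul_add (hnn _ _) (hnn _ _) (hnn _ _) ?_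
  rw [hγ.1 p.2 z]
  exact hγ.le_two_mul_add hnn p.1 p.2 z

/-- The part of the definition of `energySpace` that does not depend on the total mass can be tested
on potentials of points. -/
theorem mem_energySpace_iff (hψ : IsBernstein ψ) (hγ : IsCND γ)
    (hc : Continuous fun p : X × X => γ p.1 p.2) (hnn : ∀ x y, 0 ≤ γ x y) {μ : SignedMeasure X} :
    μ ∈ energySpace γ ψ ↔ μ.totalVariation.InnerRegularCompactLTTop ∧
      (∀ z, Integrable (fun x => ψ (γ x z)) μ.totalVariation) ∧ μ Set.univ = 0 := by
  constructor
  · rintro ⟨h1, h2, h3⟩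
    exact ⟨isRadonMeasure_iff_innerRegularCompactLTTop.1 h1,
      hγ.integrable_section hψ hc hnn h2, h3⟩
  · rintro ⟨h1, h2, h3⟩
    exact ⟨isRadonMeasure_iff_innerRegularCompactLTTop.2 h1,
      hγ.integrable_prod hψ hc hnn h2 h2, h3⟩

/-- The signed measures of finite energy and total mass zero, as a subspace. -/
def energySubmodule (hψ : IsBernstein ψ) (hγ : IsCND γ)
    (hc : Continuous fun p : X × X => γ p.1 p.2) (hnn : ∀ x y, 0 ≤ γ x y) :
    Submodule ℝ (SignedMeasure X) where
  carrier := energySpace γ ψ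
  zero_mem' := by
    rw [mem_energySpace_iff hψ hγ hc hnn, SignedMeasure.totalVariation_zero]
    exact ⟨inferInstance, fun z => integrable_zero_measure, rfl⟩
  add_mem' := by
    intro μ ν hμ hν
    rw [mem_energySpace_iff hψ hγ hc hnn] at hμ hν ⊢
    obtain ⟨h1, h2, h3⟩ := hμ
    obtain ⟨h1', h2', h3'⟩ := hν
    have hle := SignedMeasure.totalVariation_add_le μ ν
    refine ⟨?_, fun z => ((h2 z).add_measure (h2' z)).mono_measure hle, ?_⟩
    · exact (Measure.absolutelyContinuous_of_le hle).innerRegularCompactLTTop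
    · rw [add_apply, h3, h3', add_zero]
  smul_mem' := by
    intro c μ hμ
    rw [mem_energySpace_iff hψ hγ hc hnn] at hμ ⊢
    obtain ⟨h1, h2, h3⟩ := hμ
    rw [SignedMeasure.totalVariation_smul]
    refine ⟨inferInstance, fun z => (h2 z).smul_measure_nnreal, ?_⟩
    rw [smul_apply, h3, smul_zero]

end Energy

end BernsteinEnergy

/-! ### Bilinearity, positivity and definiteness. -/

theorem theorem4p1 {X : Type*} [TopologicalSpace X] [T2Space X] [MeasurableSpace X] [BorelSpace X]
    (ψ : ℝ → ℝ) (hψ : IsBernstein ψ)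
    (γ : X → X → ℝ) (hγ_nonneg : ∀ x y, 0 ≤ γ x y)
    (hγ_cont : Continuous fun p : X × X => γ p.1 p.2)
    (hγ_cnd : IsCND γ)
    (hγ_diag : BddAbove (Set.range fun x => γ x x)) :
    ∃ V : Submodule ℝ (SignedMeasure X),
      (V : Set (SignedMeasure X)) = energySpace γ ψ ∧
      (∀ μ ∈ V, ∀ ν ∈ V, Integrable (fun p : X × X => ψ (γ p.1 p.2))
        (μ.totalVariation.prod ν.totalVariation)) ∧
      ∃ B : LinearMap.BilinForm ℝ V,
        (∀ μ ν : V, B μ ν = energyForm γ ψ μ ν) ∧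
        B.IsPosSemidef ∧
        ((¬ ∃ a b : ℝ, ∀ t : ℝ, 0 ≤ t → ψ t = a + b * t) →
          (∀ x y, 2 * γ x y = γ x x + γ y y → x = y) →
          ∀ μ : V, B μ μ = 0 → μ = 0) := by
  set V := energySubmodule hψ hγ_cnd hγ_cont hγ_nonneg with hV
  have hmem : ∀ μ ∈ V, μ.totalVariation.InnerRegularCompactLTTop ∧
      (∀ z, Integrable (fun x => ψ (γ x z)) μ.totalVariation) ∧ μ Set.univ = 0 := fun μ hμ =>
    (mem_energySpace_iff hψ hγ_cnd hγ_cont hγ_nonneg).1 hμ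
  have hsec : ∀ (μ : V) z, Integrable (fun x => ψ (γ x z)) (μ : SignedMeasure X).totalVariation :=
    fun μ => (hmem μ μ.2).2.1
  have hint : ∀ μ ∈ V, ∀ ν ∈ V, Integrable (fun p : X × X => ψ (γ p.1 p.2))
      (μ.totalVariation.prod ν.totalVariation) := by
    intro μ hμ ν hν
    have := (hmem μ hμ).1
    have := (hmem ν hν).1
    exact hγ_cnd.integrable_prod hψ hγ_cont hγ_nonneg (hmem μ hμ).2.1 (hmem ν hν).2.1
  have hpot : ∀ μ ν : V, Integrable (fun y => ∫ᵛ x, ψ (γ x y) ∂•(μ : SignedMeasure X))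
      (ν : SignedMeasure X).totalVariation := fun μ ν =>
    integrable_potential (hsec μ) (hint μ μ.2 ν ν.2)
  simp only [SignedMeasure.totalVariation_eq_variation] at hsec hpot
  let B : LinearMap.BilinForm ℝ V := LinearMap.mk₂ ℝ
    (fun μ ν : V => energyForm γ ψ (μ : SignedMeasure X) (ν : SignedMeasure X))
    (fun μ μ' ν => by
      simp only [energyForm, Submodule.coe_add]
      simp_rw [VectorMeasure.integral_add_vectorMeasure (hsec μ _) (hsec μ' _)]
      rw [VectorMeasure.integral_fun_add (hpot μ ν) (hpot μ' ν), neg_add])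
    (fun c μ ν => by
      simp only [energyForm, Submodule.coe_smul, VectorMeasure.integral_smul_vectorMeasure,
        smul_eq_mul]
      simp only [← smul_eq_mul]
      rw [VectorMeasure.integral_fun_smul, smul_neg])
    (fun μ ν ν' => by
      simp only [energyForm, Submodule.coe_add]
      rw [VectorMeasure.integral_add_vectorMeasure (hpot μ ν) (hpot μ ν'), neg_add])
    (fun c μ ν => by
      simp only [energyForm, Submodule.coe_smul, VectorMeasure.integral_smul_vectorMeasure,
        smul_neg])
  simp only [← SignedMeasure.totalVariation_eq_variation] at hsec hpot
  have hB : ∀ μ ν : V, B μ ν = energyForm γ ψ μ ν := fun μ ν => rfl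
  have hdiag : ∀ μ : V, 0 ≤ B μ μ ∧ ((¬ ∃ a b : ℝ, ∀ t : ℝ, 0 ≤ t → ψ t = a + b * t) →
      (∀ x y, 2 * γ x y = γ x x + γ y y → x = y) → B μ μ = 0 → μ = 0) := by
    intro μ
    obtain ⟨s, hs, hs1, hsμ⟩ := (μ : SignedMeasure X).exists_sign
    have := (hmem μ μ.2).1
    have hsi : Integrable s (μ : SignedMeasure X).totalVariation :=
      Integrable.of_bound hs.aestronglyMeasurable 1 (Filter.Eventually.of_forall fun x => (hs1 x).le)
    obtain ⟨h1, h2⟩ := hγ_cnd.bernstein_energy_nonneg hγ_cont hγ_nonneg hsi (fun x => (hs1 x).le)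
      ((integral_sign_eq hsμ).trans (hmem μ μ.2).2.2) hψ (hint μ μ.2 μ μ.2)
    rw [hB, energyForm_eq_integral (hsec μ) (hint μ μ.2 μ μ.2) hs hs hs1 hs1 hsμ hsμ]
    refine ⟨h1, fun haff hinj h0 => ?_⟩
    refine Subtype.ext (SignedMeasure.eq_zero_of_totalVariation_eq_zero ?_)
    -- The sign has absolute value 1 everywhere yet vanishes almost everywhere, so the total
    -- variation is zero.
    rw [← ae_eq_bot]
    refine Filter.eventually_false_iff_eq_bot.1 ?_
    filter_upwards [h2 haff hinj h0] with x hx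
    have := hs1 x
    rw [hx] at this
    simp at this
  refine ⟨V, rfl, hint, B, hB, ⟨⟨fun μ ν => ?_⟩, ⟨fun μ => (hdiag μ).1⟩⟩,
    fun haff hinj μ => (hdiag μ).2 haff hinj⟩
  obtain ⟨s, hs, hs1, hsμ⟩ := (μ : SignedMeasure X).exists_sign
  obtain ⟨t, ht, ht1, htν⟩ := (ν : SignedMeasure X).exists_sign
  rw [hB, hB, energyForm_eq_integral (hsec μ) (hint μ μ.2 ν ν.2) hs ht hs1 ht1 hsμ htν,
    energyForm_eq_integral (hsec ν) (hint ν ν.2 μ μ.2) ht hs ht1 hs1 htν hsμ,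
    ← integral_prod_swap]
  congr 2
  ext p
  simp only [Prod.fst_swap, Prod.snd_swap, hγ_cnd.1 p.2 p.1]
  ring
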